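/- Let $B$ be a unital $C^*$-algebra, let $I$ be a closed two-sided ideal of $B$, and let $\pi\colon B\to B/I$ be the quotient map. Let $V(I)$ be the abelian monoid of Murray–von Neumann equivalence classes of projections in $M_\infty(I)$, and let $\delta\colon K_1(B/I)\to K_0(I)$ be the index map, with the sign convention $\delta[u]=[zp_nz^*]-[p_n]$, where $u\in M_n(B/I)$ is unitary, $z\in M_{2n}(B)$ is a unitary lift of $u\oplus u^*$, and $p_n=1_n\oplus 0_n$. Order $K_0(I)$ by taking the image of $V(I)$ as positive cone: $x\le y$ if and only if $y-x$ is the class of some element of $V(I)$, and $x<y$ means $x\le y$ and $x\neq y$. Suppose that $I$ has real rank zero (the invertible self-adjoint elements of the unitization of $I$ are dense in its self-adjoint elements) and that $V(I)$ is cancellative. Then for every unitary $w\in B/I$: 1. there is a unitary $z\in B$ with $\pi(z)=w$ if and only if $\delta[w]=0$; 2. there is a proper isometry $z\in B$ (that is, $z^*z=1\neq zz^*$) with $\pi(z)=w$ if and only if $\delta[w]<0$; 3. there is a proper co-isometry $z\in B$ (that is, $zz^*=1\neq z^*z$) with $\pi(z)=w$ if and only if $\delta[w]>0$. -/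

import Mathlib

/-! ## The quotient of a unital C*-algebra by a closed two-sided ideal -/

section ClosedIdeals

variable {B : Type*} [CStarAlgebra B]

theorem ClosedIdeal.exists_approx (I : Ideal B) [I.IsTwoSided] {i : B} (hi : i ∈ I)
    {ε : ℝ} (hε : 0 < ε) :
    ∃ e ∈ I, IsSelfAdjoint e ∧ ‖1 - e‖ ≤ 1 ∧ ‖i * (1 - e)‖ ≤ ε := by
  set a : B := star i * i with ha
  have hasa : IsSelfAdjoint a := IsSelfAdjoint.star_mul_self i
  have hspec : ∀ x ∈ spectrum ℝ a, 0 ≤ x := spectrum_star_mul_self_nonneg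
  set d : ℝ := ε ^ 2 with hd
  have hd0 : 0 < d := by positivity
  have hne : ∀ x ∈ spectrum ℝ a, x + d ≠ 0 := fun x hx => by
    have := hspec x hx
    positivity
  have hg : ContinuousOn (fun x : ℝ => (x + d)⁻¹) (spectrum ℝ a) :=
    ContinuousOn.inv₀ (by fun_prop) hne
  set e : B := cfc (fun x : ℝ => x * (x + d)⁻¹) a with he
  have hf : ContinuousOn (fun x : ℝ => x * (x + d)⁻¹) (spectrum ℝ a) :=
    continuousOn_id.mul hg
  have heI : e ∈ I := by
    have h1 : e = a * cfc (fun x : ℝ => (x + d)⁻¹) a := by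
      rw [he, cfc_mul (fun x : ℝ => x) (fun x : ℝ => (x + d)⁻¹) a continuousOn_id hg,
        cfc_id' ℝ a]
    rw [h1]
    exact I.mul_mem_right _ (I.mul_mem_left _ hi)
  have hesa : IsSelfAdjoint e := cfc_predicate _ a
  have h1e : 1 - e = cfc (fun x : ℝ => 1 - x * (x + d)⁻¹) a := by
    rw [cfc_sub (fun _ : ℝ => (1 : ℝ)) (fun x : ℝ => x * (x + d)⁻¹) a continuousOn_const hf,
      cfc_const_one ℝ a]
  have h1esa : IsSelfAdjoint (1 - e) := (IsSelfAdjoint.one B).sub hesa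
  refine ⟨e, heI, hesa, ?_, ?_⟩
  · rw [h1e]
    refine norm_cfc_le zero_le_one fun x hx => ?_
    have hx0 := hspec x hx
    have h2 : 1 - x * (x + d)⁻¹ = d / (x + d) := by
      field_simp
      ring
    rw [h2, Real.norm_of_nonneg (by positivity)]
    exact (div_le_one (by positivity)).2 (by linarith)
  · have h3 : star (i * (1 - e)) * (i * (1 - e)) =
        cfc (fun x : ℝ => (1 - x * (x + d)⁻¹) * (x * (1 - x * (x + d)⁻¹))) a := by
      have hc : ContinuousOn (fun x : ℝ => 1 - x * (x + d)⁻¹) (spectrum ℝ a) :=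
        continuousOn_const.sub hf
      rw [cfc_mul (fun x : ℝ => 1 - x * (x + d)⁻¹) (fun x : ℝ => x * (1 - x * (x + d)⁻¹)) a hc
        (continuousOn_id.mul hc),
        cfc_mul (fun x : ℝ => x) (fun x : ℝ => 1 - x * (x + d)⁻¹) a continuousOn_id hc,
        cfc_id' ℝ a, ← h1e, star_mul, h1esa.star_eq, ha]
      simp only [mul_assoc]
    have h4 : ‖i * (1 - e)‖ * ‖i * (1 - e)‖ ≤ d := by
      rw [← CStarRing.norm_star_mul_self, h3]
      refine norm_cfc_le hd0.le fun x hx => ?_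
      have hx0 := hspec x hx
      have h2 : 1 - x * (x + d)⁻¹ = d / (x + d) := by
        field_simp
        ring
      have h5 : d / (x + d) ≤ 1 := (div_le_one (by positivity)).2 (by linarith)
      have h6 : x * (d / (x + d)) ≤ d := by
        rw [mul_div_assoc', div_le_iff₀ (by positivity)]
        nlinarith
      simp only [h2]
      rw [Real.norm_of_nonneg (by positivity)]
      calc d / (x + d) * (x * (d / (x + d))) ≤ 1 * d :=
            mul_le_mul h5 h6 (by positivity) zero_le_one
        _ = d := one_mul d
    exact abs_le_of_sq_le_sq' (by nlinarith) hε.le |>.2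

/-- A closed two-sided ideal of a C*-algebra is closed under the involution. -/
theorem ClosedIdeal.star_mem (I : Ideal B) [I.IsTwoSided] [hI : IsClosed (I : Set B)] {i : B}
    (hi : i ∈ I) : star i ∈ I := by
  have h : star i ∈ closure (I : Set B) := by
    refine Metric.mem_closure_iff.2 fun ε hε => ?_
    obtain ⟨e, heI, hesa, -, h2⟩ := ClosedIdeal.exists_approx I hi (half_pos hε)
    refine ⟨e * star i, I.mul_mem_right _ heI, ?_⟩
    have h3 : star i - e * star i = star (i * (1 - e)) := by
      rw [star_mul, star_sub, star_one, hesa.star_eq, sub_mul, one_mul]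
    rw [dist_eq_norm, h3, norm_star]
    linarith
  rwa [hI.closure_eq] at h

/-- A closed two-sided ideal of a C*-algebra `B`, viewed as a (non-unital) C*-subalgebra. -/
def ClosedIdeal.toSubalgebra (I : Ideal B) [I.IsTwoSided] [IsClosed (I : Set B)] :
    NonUnitalStarSubalgebra ℂ B where
  carrier := I
  add_mem' := I.add_mem
  zero_mem' := I.zero_mem
  mul_mem' := fun {a _} _ hb => I.mul_mem_left a hb
  smul_mem' := fun c x hx => by
    rw [← smul_one_mul c x]
    exact I.mul_mem_left _ hx
  star_mem' := fun hx => ClosedIdeal.star_mem I hx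

instance ClosedIdeal.isClosed_toSubalgebra (I : Ideal B) [I.IsTwoSided]
    [hI : IsClosed (I : Set B)] :
    IsClosed ((ClosedIdeal.toSubalgebra I : NonUnitalStarSubalgebra ℂ B) : Set B) := hI

variable (I : Ideal B) [I.IsTwoSided] [IsClosed (I : Set B)]

/-- The quotient norm makes `B ⧸ I` a normed ring. -/
noncomputable instance ClosedIdeal.Quotient.normedRing : NormedRing (B ⧸ I) :=
  { Submodule.Quotient.normedAddCommGroup I, Ideal.Quotient.ring I with
    norm_mul_le := fun x y => by
      refine le_of_forall_pos_le_add fun ε hε => ?_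
      have hcont : Filter.Tendsto (fun t : ℝ => (‖x‖ + t) * (‖y‖ + t)) (nhdsWithin 0 (Set.Ioi 0))
          (nhds ((‖x‖ + 0) * (‖y‖ + 0))) :=
        (Continuous.tendsto (by fun_prop) 0).mono_left nhdsWithin_le_nhds
      have hlt : (‖x‖ + 0) * (‖y‖ + 0) < ‖x‖ * ‖y‖ + ε := by simpa using hε
      obtain ⟨t, ht, ht0⟩ :=
        ((hcont.eventually_lt_const hlt).and self_mem_nhdsWithin).exists
      obtain ⟨a, rfl, ha⟩ := Submodule.Quotient.norm_mk_lt x ht0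
      obtain ⟨b, rfl, hb⟩ := Submodule.Quotient.norm_mk_lt y ht0
      calc _ ≤ ‖a * b‖ := Submodule.Quotient.norm_mk_le I (a * b)
        _ ≤ ‖a‖ * ‖b‖ := norm_mul_le a b
        _ ≤ _ := mul_le_mul ha.le hb.le (norm_nonneg _) ((norm_nonneg _).trans ha.le)
        _ ≤ _ := ht.le }

/-- The involution of `B ⧸ I`, given by `(b + I)* = b* + I`. -/
noncomputable instance ClosedIdeal.Quotient.starRing : StarRing (B ⧸ I) where
  star := Quotient.map' star fun a b h => by
    rw [Submodule.quotientRel_def] at h ⊢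
    rw [← star_sub]
    exact ClosedIdeal.star_mem I h
  star_involutive := by
    rintro ⟨a⟩
    exact congrArg (Submodule.Quotient.mk (p := I)) (star_star a)
  star_mul := by
    rintro ⟨a⟩ ⟨b⟩
    exact congrArg (Submodule.Quotient.mk (p := I)) (star_mul a b)
  star_add := by
    rintro ⟨a⟩ ⟨b⟩
    exact congrArg (Submodule.Quotient.mk (p := I)) (star_add a b)

theorem ClosedIdeal.Quotient.star_mk (a : B) :
    star (Ideal.Quotient.mk I a) = Ideal.Quotient.mk I (star a) := rfl

/-- `B ⧸ I` with the quotient norm and the quotient involution is a C*-algebra. -/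
noncomputable instance ClosedIdeal.Quotient.cstarAlgebra : CStarAlgebra (B ⧸ I) where
  toCompleteSpace := Submodule.Quotient.completeSpace I
  norm_mul_self_le := by
    intro x
    refine le_of_forall_pos_le_add fun ε hε => ?_
    obtain ⟨a, rfl⟩ := Ideal.Quotient.mk_surjective x
    obtain ⟨y, hy, hyn⟩ := Submodule.Quotient.norm_mk_lt
      (star (Ideal.Quotient.mk I a) * Ideal.Quotient.mk I a : B ⧸ I) (half_pos hε)
    have hi : star a * a - y ∈ I := by
      rw [← Ideal.Quotient.eq_zero_iff_mem, map_sub, map_mul,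
        ← ClosedIdeal.Quotient.star_mk, sub_eq_zero]
      exact hy.symm
    obtain ⟨e, heI, hesa, h1, h2⟩ := ClosedIdeal.exists_approx I hi (half_pos hε)
    have h1esa : star (1 - e) = 1 - e := ((IsSelfAdjoint.one B).sub hesa).star_eq
    have hle : ‖Ideal.Quotient.mk I a‖ ≤ ‖a * (1 - e)‖ := by
      have h3 : Ideal.Quotient.mk I a = Ideal.Quotient.mk I (a * (1 - e)) := by
        rw [mul_sub, mul_one, map_sub,
          Ideal.Quotient.eq_zero_iff_mem.2 (I.mul_mem_left a heI), sub_zero]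
      rw [h3]
      exact Submodule.Quotient.norm_mk_le I _
    have h4 : star (a * (1 - e)) * (a * (1 - e)) =
        (1 - e) * y * (1 - e) + (1 - e) * ((star a * a - y) * (1 - e)) := by
      rw [star_mul, h1esa]
      noncomm_ring
    calc ‖Ideal.Quotient.mk I a‖ * ‖Ideal.Quotient.mk I a‖
        ≤ ‖a * (1 - e)‖ * ‖a * (1 - e)‖ :=
          mul_le_mul hle hle (norm_nonneg _) (norm_nonneg _)
      _ = ‖(1 - e) * y * (1 - e) + (1 - e) * ((star a * a - y) * (1 - e))‖ := by
          rw [← CStarRing.norm_star_mul_self, h4]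
      _ ≤ ‖(1 - e) * y * (1 - e)‖ + ‖(1 - e) * ((star a * a - y) * (1 - e))‖ := norm_add_le _ _
      _ ≤ 1 * ‖y‖ * 1 + 1 * (ε / 2) := by
          refine add_le_add ?_ ?_
          · refine (norm_mul_le _ _).trans (mul_le_mul ?_ h1 (norm_nonneg _) (by positivity))
            exact (norm_mul_le _ _).trans (mul_le_mul_of_nonneg_right h1 (norm_nonneg _))
          · exact (norm_mul_le _ _).trans (mul_le_mul h1 h2 (norm_nonneg _) zero_le_one)
      _ ≤ _ := by linarith
  norm_smul_le := fun c x => norm_smul_le c x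
  star_smul := by
    rintro c ⟨a⟩
    exact congrArg (Submodule.Quotient.mk (p := I)) (star_smul c a)

end ClosedIdeals

/-! ## The monoid `V(A)` of Murray-von Neumann classes of projections in `M_∞(A)` -/

namespace KTheory

open Matrix

section Projections

variable {A : Type*} [NonUnitalRing A] [StarRing A]
  {ι κ μ ι' κ' : Type*} [Fintype ι] [Fintype κ] [Fintype μ] [Fintype ι'] [Fintype κ']

/-- Murray-von Neumann equivalence of square matrices `p`, `q` over `A`, possibly of different
sizes: `p = v*v` and `q = vv*` for a rectangular matrix `v` over `A`. -/
def MvN (p : Matrix ι ι A) (q : Matrix κ κ A) : Prop :=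
  ∃ v : Matrix κ ι A, vᴴ * v = p ∧ v * vᴴ = q

theorem MvN.refl {p : Matrix ι ι A} (hp : IsStarProjection p) : MvN p p := by
  have h1 : pᴴ = p := hp.isSelfAdjoint
  have h2 : p * p = p := hp.isIdempotentElem
  exact ⟨p, by rw [h1, h2], by rw [h1, h2]⟩

theorem MvN.symm {p : Matrix ι ι A} {q : Matrix κ κ A} (h : MvN p q) : MvN q p := by
  obtain ⟨v, h1, h2⟩ := h
  exact ⟨vᴴ, by rwa [conjTranspose_conjTranspose], by rwa [conjTranspose_conjTranspose]⟩

theorem MvN.trans {p : Matrix ι ι A} {q : Matrix κ κ A} {r : Matrix μ μ A}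
    (hp : IsStarProjection p) (hr : IsStarProjection r) (h : MvN p q) (h' : MvN q r) :
    MvN p r := by
  obtain ⟨v, h1, h2⟩ := h
  obtain ⟨u, h3, h4⟩ := h'
  have hp2 : p * p = p := hp.isIdempotentElem
  have hr2 : r * r = r := hr.isIdempotentElem
  refine ⟨u * v, ?_, ?_⟩
  · calc (u * v)ᴴ * (u * v) = vᴴ * (uᴴ * u) * v := by
          rw [conjTranspose_mul]; simp only [Matrix.mul_assoc]
      _ = (vᴴ * v) * (vᴴ * v) := by rw [h3, ← h2]; simp only [Matrix.mul_assoc]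
      _ = p := by rw [h1, hp2]
  · calc (u * v) * (u * v)ᴴ = u * (v * vᴴ) * uᴴ := by
          rw [conjTranspose_mul]; simp only [Matrix.mul_assoc]
      _ = (u * uᴴ) * (u * uᴴ) := by rw [h2, ← h3]; simp only [Matrix.mul_assoc]
      _ = r := by rw [h4, hr2]

theorem isStarProjection_reindex {p : Matrix ι ι A} (hp : IsStarProjection p) (e : ι ≃ κ) :
    IsStarProjection (p.reindex e e) := by
  have h1 : pᴴ = p := hp.isSelfAdjoint
  have h2 : p * p = p := hp.isIdempotentElem
  refine ⟨?_, ?_⟩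
  · change p.submatrix e.symm e.symm * p.submatrix e.symm e.symm = _
    rw [submatrix_mul_equiv, h2]
    rfl
  · change (p.submatrix e.symm e.symm)ᴴ = _
    rw [conjTranspose_submatrix, h1]
    rfl

theorem MvN.reindex {p : Matrix ι ι A} (hp : IsStarProjection p) (e : ι ≃ κ) :
    MvN p (p.reindex e e) := by
  have h1 : pᴴ = p := hp.isSelfAdjoint
  have h2 : p * p = p := hp.isIdempotentElem
  refine ⟨p.submatrix e.symm id, ?_, ?_⟩
  · rw [conjTranspose_submatrix, h1, submatrix_mul_equiv, h2, submatrix_id_id]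
  · rw [conjTranspose_submatrix, h1, ← submatrix_mul _ _ _ _ _ Function.bijective_id, h2]
    rfl

theorem isStarProjection_fromBlocks {p : Matrix ι ι A} {q : Matrix κ κ A}
    (hp : IsStarProjection p) (hq : IsStarProjection q) :
    IsStarProjection (fromBlocks p 0 0 q) := by
  have h1 : pᴴ = p := hp.isSelfAdjoint
  have h2 : p * p = p := hp.isIdempotentElem
  have h3 : qᴴ = q := hq.isSelfAdjoint
  have h4 : q * q = q := hq.isIdempotentElem
  refine ⟨?_, ?_⟩
  · change _ * _ = _
    simp [fromBlocks_multiply, h2, h4]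
  · change (fromBlocks p 0 0 q)ᴴ = _
    simp [fromBlocks_conjTranspose, h1, h3]

theorem MvN.fromBlocks {p : Matrix ι ι A} {q : Matrix κ κ A} {p' : Matrix ι' ι' A}
    {q' : Matrix κ' κ' A} (h : MvN p p') (h' : MvN q q') :
    MvN (fromBlocks p 0 0 q) (fromBlocks p' 0 0 q') := by
  obtain ⟨v, h1, h2⟩ := h
  obtain ⟨u, h3, h4⟩ := h'
  refine ⟨Matrix.fromBlocks v 0 0 u, ?_, ?_⟩
  · simp [fromBlocks_conjTranspose, fromBlocks_multiply, h1, h3]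
  · simp [fromBlocks_conjTranspose, fromBlocks_multiply, h2, h4]

end Projections

/-- The projections in `M_∞(A) = ⋃ₙ Mₙ(A)`. -/
structure Proj (A : Type*) [NonUnitalRing A] [StarRing A] where
  n : ℕ
  mat : Matrix (Fin n) (Fin n) A
  isProj : IsStarProjection mat

section V

variable (A : Type*) [NonUnitalRing A] [StarRing A]

instance Proj.setoid : Setoid (Proj A) where
  r p q := MvN p.mat q.mat
  iseqv :=
    { refl := fun p => MvN.refl p.isProj
      symm := fun h => h.symm
      trans := fun {p _ r} h h' => MvN.trans p.isProj r.isProj h h' }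

/-- `V(A)`: the Murray-von Neumann classes of projections of `M_∞(A)`. -/
def V : Type _ := Quotient (Proj.setoid A)

variable {A}

/-- The class in `V(A)` of a projection in a matrix algebra over `A`. -/
noncomputable def V.mk {ι : Type*} [Fintype ι] (p : Matrix ι ι A) (hp : IsStarProjection p) :
    V A :=
  Quotient.mk (Proj.setoid A) ⟨Fintype.card ι, p.reindex (Fintype.equivFin ι) (Fintype.equivFin ι),
    isStarProjection_reindex hp _⟩

theorem V.mk_eq_mk {ι κ : Type*} [Fintype ι] [Fintype κ] {p : Matrix ι ι A} {q : Matrix κ κ A}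
    {hp : IsStarProjection p} {hq : IsStarProjection q} :
    V.mk p hp = V.mk q hq ↔ MvN p q := by
  have ep := MvN.reindex hp (Fintype.equivFin ι)
  have eq := MvN.reindex hq (Fintype.equivFin κ)
  have hp' := isStarProjection_reindex hp (Fintype.equivFin ι)
  have hq' := isStarProjection_reindex hq (Fintype.equivFin κ)
  constructor
  · intro h
    have h' : MvN _ _ := Quotient.exact h
    exact ep.trans hp hq (h'.trans hp' hq eq.symm)
  · intro h
    exact Quotient.sound (ep.symm.trans hp' hq' (h.trans hp hq' eq))

theorem V.ind {P : V A → Prop}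
    (h : ∀ (n : ℕ) (p : Matrix (Fin n) (Fin n) A) (hp : IsStarProjection p), P (V.mk p hp))
    (x : V A) : P x := by
  induction x using Quotient.inductionOn with
  | h p =>
    have : V.mk p.mat p.isProj = Quotient.mk _ p :=
      Quotient.sound (MvN.reindex p.isProj _).symm
    rw [← this]
    exact h p.n p.mat p.isProj

/-- The addition of `V(A)`, given by `[p] + [q] = [p ⊕ q]`. -/
noncomputable instance : Add (V A) where
  add := Quotient.map₂
    (fun p q => ⟨Fintype.card (Fin p.n ⊕ Fin q.n),
      (fromBlocks p.mat 0 0 q.mat).reindex (Fintype.equivFin _) (Fintype.equivFin _),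
      isStarProjection_reindex (isStarProjection_fromBlocks p.isProj q.isProj) _⟩)
    (fun p p' h q q' h' => by
      have h1 := isStarProjection_fromBlocks p.isProj q.isProj
      have h2 := isStarProjection_fromBlocks p'.isProj q'.isProj
      exact V.mk_eq_mk (hp := h1) (hq := h2) |>.2 (MvN.fromBlocks h h') |> Quotient.exact)

theorem V.mk_add_mk {ι κ : Type*} [Fintype ι] [Fintype κ] {p : Matrix ι ι A} {q : Matrix κ κ A}
    (hp : IsStarProjection p) (hq : IsStarProjection q) :
    V.mk p hp + V.mk q hq = V.mk (fromBlocks p 0 0 q) (isStarProjection_fromBlocks hp hq) :=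
  (V.mk_eq_mk (hp := isStarProjection_fromBlocks (isStarProjection_reindex hp _)
    (isStarProjection_reindex hq _)) (hq := isStarProjection_fromBlocks hp hq)).2
    (MvN.fromBlocks (MvN.reindex hp _).symm (MvN.reindex hq _).symm)

noncomputable instance : Zero (V A) where
  zero := V.mk (0 : Matrix (Fin 0) (Fin 0) A) (IsStarProjection.zero _)

theorem V.zero_def : (0 : V A) = V.mk (0 : Matrix (Fin 0) (Fin 0) A) (.zero _) := rfl

/-- `V(A)` is an abelian monoid. -/
noncomputable instance V.addCommMonoid : AddCommMonoid (V A) where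
  add_assoc x y z := by
    induction x using V.ind with | _ n p hp
    induction y using V.ind with | _ m q hq
    induction z using V.ind with | _ l r hr
    rw [V.mk_add_mk, V.mk_add_mk, V.mk_add_mk, V.mk_add_mk, V.mk_eq_mk]
    convert MvN.reindex (isStarProjection_fromBlocks (isStarProjection_fromBlocks hp hq) hr)
      (Equiv.sumAssoc _ _ _) using 1
    ext (i | i | i) (j | j | j) <;> simp
  add_comm x y := by
    induction x using V.ind with | _ n p hp
    induction y using V.ind with | _ m q hq
    rw [V.mk_add_mk, V.mk_add_mk, V.mk_eq_mk]
    convert MvN.reindex (isStarProjection_fromBlocks hp hq) (Equiv.sumComm _ _) using 1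
    ext (i | i) (j | j) <;> simp
  zero_add x := by
    induction x using V.ind with | _ n p hp
    change V.mk _ _ + _ = _
    rw [V.mk_add_mk, V.mk_eq_mk]
    refine (MvN.symm ?_)
    convert MvN.reindex hp (Equiv.emptySum (Fin 0) (Fin n)).symm using 1
    ext (i | i) (j | j)
    · exact i.elim0
    · exact i.elim0
    · exact j.elim0
    · simp
  add_zero x := by
    induction x using V.ind with | _ n p hp
    change _ + V.mk _ _ = _
    rw [V.mk_add_mk, V.mk_eq_mk]
    refine (MvN.symm ?_)
    convert MvN.reindex hp (Equiv.sumEmpty (Fin n) (Fin 0)).symm using 1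
    ext (i | i) (j | j)
    · simp
    · exact j.elim0
    · exact i.elim0
    · exact i.elim0
  nsmul := nsmulRec

variable {C : Type*} [NonUnitalRing C] [StarRing C]

theorem MvN.map {ι κ : Type*} [Fintype ι] [Fintype κ] (f : A →⋆ₙ+* C) {p : Matrix ι ι A}
    {q : Matrix κ κ A} (h : MvN p q) : MvN (p.map f) (q.map f) := by
  obtain ⟨v, rfl, rfl⟩ := h
  refine ⟨v.map f, ?_, ?_⟩
  · rw [← conjTranspose_map f (map_star f), Matrix.map_mul]
  · rw [← conjTranspose_map f (map_star f), Matrix.map_mul]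

theorem isStarProjection_map {ι : Type*} [Fintype ι] (f : A →⋆ₙ+* C) {p : Matrix ι ι A}
    (hp : IsStarProjection p) : IsStarProjection (p.map f) := by
  have h1 : pᴴ = p := hp.isSelfAdjoint
  have h2 : p * p = p := hp.isIdempotentElem
  refine ⟨?_, ?_⟩
  · change _ * _ = _
    rw [← Matrix.map_mul, h2]
  · change (p.map f)ᴴ = _
    rw [← conjTranspose_map f (map_star f), h1]

/-- The map `V(A) → V(C)`, `[p] ↦ [f(p)]`, induced by a *-homomorphism `f : A → C`. -/
noncomputable def V.mapFun (f : A →⋆ₙ+* C) : V A → V C :=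
  Quotient.map (fun p => ⟨p.n, p.mat.map f, isStarProjection_map f p.isProj⟩)
    (fun _ _ h => MvN.map f h)

theorem V.mapFun_mk (f : A →⋆ₙ+* C) {ι : Type*} [Fintype ι] {p : Matrix ι ι A}
    (hp : IsStarProjection p) :
    V.mapFun f (V.mk p hp) = V.mk (p.map f) (isStarProjection_map f hp) := rfl

/-- The monoid homomorphism `V(A) → V(C)` induced by a *-homomorphism `A → C`. -/
noncomputable def V.map (f : A →⋆ₙ+* C) : V A →+ V C where
  toFun := V.mapFun f
  map_zero' := by
    change V.mapFun f (V.mk _ _) = V.mk _ _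
    rw [V.mapFun_mk]
    congr 1
    ext i
    exact i.elim0
  map_add' x y := by
    induction x using V.ind with | _ n p hp
    induction y using V.ind with | _ m q hq
    rw [V.mk_add_mk, V.mapFun_mk, V.mapFun_mk, V.mapFun_mk, V.mk_add_mk]
    congr 1
    rw [fromBlocks_map]
    simp [Matrix.map_zero]

theorem V.map_mk (f : A →⋆ₙ+* C) {ι : Type*} [Fintype ι] {p : Matrix ι ι A}
    (hp : IsStarProjection p) :
    V.map f (V.mk p hp) = V.mk (p.map f) (isStarProjection_map f hp) := rfl

end V

/-! ## `K₀` -/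

/-- `K₀` of a unital algebra: the Grothendieck group of `V(A)`. -/
abbrev K0Unital (A : Type*) [Ring A] [StarRing A] : Type _ :=
  Algebra.GrothendieckAddGroup (V A)

/-- The class `[p] ∈ K₀(A)` of a projection in a matrix algebra over a unital algebra `A`. -/
noncomputable def K0Unital.mk {A : Type*} [Ring A] [StarRing A] {ι : Type*} [Fintype ι]
    (p : Matrix ι ι A) (hp : IsStarProjection p) : K0Unital A :=
  Algebra.GrothendieckAddGroup.of (V.mk p hp)

/-- The homomorphism `K₀(A) → K₀(C)` induced by a *-homomorphism of unital algebras. -/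
noncomputable def K0Unital.map {A C : Type*} [Ring A] [StarRing A] [Ring C] [StarRing C]
    (f : A →⋆ₙ+* C) : K0Unital A →+ K0Unital C :=
  Algebra.GrothendieckAddGroup.lift (Algebra.GrothendieckAddGroup.of.comp (V.map f))

section K0

variable (A : Type*) [NonUnitalCStarAlgebra A]

/-- The canonical character `A⁺ → ℂ`, `(λ, a) ↦ λ`, of the unitization `A⁺ = ℂ ⊕ A`. -/
def scalarPart : Unitization ℂ A →⋆ₙ+* ℂ where
  toFun x := x.fst
  map_mul' := Unitization.fst_mul
  map_zero' := Unitization.fst_zero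
  map_add' := Unitization.fst_add
  map_star' := Unitization.fst_star

@[simp] theorem scalarPart_apply (x : Unitization ℂ A) : scalarPart A x = x.fst := rfl

/-- The inclusion `A → A⁺` of a C*-algebra in its unitization. -/
def unitizationInr : A →⋆ₙ+* Unitization ℂ A where
  toFun a := (a : Unitization ℂ A)
  map_mul' := Unitization.inr_mul ℂ
  map_zero' := Unitization.inr_zero ℂ
  map_add' := Unitization.inr_add ℂ
  map_star' := Unitization.inr_star

@[simp] theorem unitizationInr_apply (a : A) :
    unitizationInr A a = (a : Unitization ℂ A) := rfl

/-- `K₀(A)` of a (possibly non-unital) C*-algebra: the kernel of `K₀(A⁺) → K₀(ℂ)`. -/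
def K0 : Type _ := (K0Unital.map (scalarPart A)).ker

noncomputable instance : AddCommGroup (K0 A) :=
  inferInstanceAs (AddCommGroup (K0Unital.map (scalarPart A)).ker)

variable {A}

/-- The inclusion `K₀(A) → K₀(A⁺)`. -/
noncomputable def K0.incl : K0 A →+ K0Unital (Unitization ℂ A) :=
  (K0Unital.map (scalarPart A)).ker.subtype

/-- The canonical homomorphism `V(A) → K₀(A)`, `[p] ↦ [p]`. -/
noncomputable def K0.ofV : V A →+ K0 A :=
  AddMonoidHom.codRestrict
    (Algebra.GrothendieckAddGroup.of.comp (V.map (unitizationInr A))) _ <| fun x => by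
    have h : (V.map (scalarPart A)) (V.map (unitizationInr A) x) = 0 := by
      induction x using V.ind with | _ n p hp
      rw [V.map_mk, V.map_mk, V.zero_def, V.mk_eq_mk]
      refine ⟨0, ?_, by ext i; exact i.elim0⟩
      ext i j
      simp only [Matrix.mul_zero, Matrix.zero_apply]
      rfl
    rw [AddMonoidHom.mem_ker]
    change Algebra.GrothendieckAddGroup.lift _ (Algebra.GrothendieckAddGroup.of _) = 0
    rw [← AddMonoidHom.comp_apply, ← Algebra.GrothendieckAddGroup.lift_symm_apply,
      Equiv.symm_apply_apply, AddMonoidHom.comp_apply, h, map_zero]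

/-- The preordering of `K₀(A)` whose positive cone is the image of `V(A)`. -/
noncomputable instance : LE (K0 A) := ⟨fun x y => ∃ a : V A, y = x + K0.ofV a⟩

/-- `x < y` means `x ≤ y` and `x ≠ y`. -/
noncomputable instance : LT (K0 A) := ⟨fun x y => x ≤ y ∧ x ≠ y⟩

end K0

/-! ## `K₁` -/

section K1

variable (A : Type*) [CStarAlgebra A]

/-- The unitaries of all matrix algebras `Mₙ(A)`. -/
def MatUnitary : Type _ := Σ n : ℕ, unitary (Matrix (Fin n) (Fin n) A)

/-- The identifications that define `K₁(A)`: `u ∼ v` if `u` and `v` are joined by a norm continuous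
path of unitaries in `Mₙ(A)`, and `u ∼ u ⊕ 1`. -/
inductive K1.Rel : MatUnitary A → MatUnitary A → Prop
  | homotopy {n : ℕ} (u v : unitary (Matrix (Fin n) (Fin n) A)) (h : Joined u v) :
      K1.Rel ⟨n, u⟩ ⟨n, v⟩
  | stabilize {n : ℕ} (u : unitary (Matrix (Fin n) (Fin n) A))
      (v : unitary (Matrix (Fin (n + 1)) (Fin (n + 1)) A))
      (h : (v : Matrix (Fin (n + 1)) (Fin (n + 1)) A) =
        (fromBlocks (u : Matrix (Fin n) (Fin n) A) 0 0 (1 : Matrix (Fin 1) (Fin 1) A)).reindex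
          finSumFinEquiv finSumFinEquiv) :
      K1.Rel ⟨n, u⟩ ⟨n + 1, v⟩

/-- `K₁(A)` of a unital C*-algebra: the set of classes of unitaries in matrix algebras over `A` up
to homotopy and stabilization, i.e. the union over `n` of the sets `π₀(Uₙ(A))` along `u ↦ u ⊕ 1`.
(The group operation of `K₁(A)` is not needed here.) -/
def K1 : Type _ := Quot (K1.Rel A)

variable {A}

/-- The class in `K₁(A)` of a unitary in `Mₙ(A)`. -/
def K1.mk {n : ℕ} (u : unitary (Matrix (Fin n) (Fin n) A)) : K1 A := Quot.mk _ ⟨n, u⟩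

/-- A unitary of `A` as a unitary `1 × 1` matrix. -/
def matOne (w : unitary A) : unitary (Matrix (Fin 1) (Fin 1) A) :=
  ⟨diagonal fun _ => (w : A), by
    rw [Unitary.mem_iff, star_eq_conjTranspose, diagonal_conjTranspose, diagonal_mul_diagonal,
      diagonal_mul_diagonal]
    simp [Pi.star_apply]⟩

/-- The class `[w] ∈ K₁(A)` of a unitary `w` of `A`. -/
def K1.ofUnitary (w : unitary A) : K1 A := K1.mk (matOne w)

end K1

/-! ## The index map -/

section Index

variable {B : Type*} [CStarAlgebra B] (I : Ideal B) [I.IsTwoSided] [IsClosed (I : Set B)]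

/-- The *-homomorphism `I⁺ → B`, `(λ, x) ↦ λ1 + x`. -/
noncomputable def unitizationToAlgebra :
    Unitization ℂ (ClosedIdeal.toSubalgebra I) →⋆ₐ[ℂ] B :=
  Unitization.starLift (NonUnitalStarSubalgebraClass.subtype (ClosedIdeal.toSubalgebra I))

/-- The projection `pₙ = 1ₙ ⊕ 0ₙ` in `M₂ₙ(R)`. -/
def basicProj (R : Type*) [Ring R] (n : ℕ) : Matrix (Fin n ⊕ Fin n) (Fin n ⊕ Fin n) R :=
  fromBlocks 1 0 0 0

theorem isStarProjection_basicProj (R : Type*) [Ring R] [StarRing R] (n : ℕ) :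
    IsStarProjection (basicProj R n) :=
  isStarProjection_fromBlocks (.one _) (.zero _)

/-- `IsIndex I u k` says that `k ∈ K₀(I)` is an index of the unitary `u ∈ Mₙ(B/I)`: there is
a unitary `z ∈ M₂ₙ(B)` that lifts `u ⊕ u*`, and `k = [z pₙ z*] - [pₙ]`. Here `z pₙ z*` is viewed
as the projection `P` over `I⁺` whose image over `B` is `z pₙ z*` and whose scalar part
is `pₙ`. -/
def IsIndex {n : ℕ} (u : unitary (Matrix (Fin n) (Fin n) (B ⧸ I)))
    (k : K0 (ClosedIdeal.toSubalgebra I)) : Prop :=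
  ∃ z : unitary (Matrix (Fin n ⊕ Fin n) (Fin n ⊕ Fin n) B),
    (z : Matrix (Fin n ⊕ Fin n) (Fin n ⊕ Fin n) B).map (Ideal.Quotient.mk I) =
      fromBlocks (u : Matrix (Fin n) (Fin n) (B ⧸ I)) 0 0
        (star (u : Matrix (Fin n) (Fin n) (B ⧸ I))) ∧
    ∃ (P : Matrix (Fin n ⊕ Fin n) (Fin n ⊕ Fin n)
          (Unitization ℂ (ClosedIdeal.toSubalgebra I))) (hP : IsStarProjection P),
      P.map (unitizationToAlgebra I) =
        (z : Matrix (Fin n ⊕ Fin n) (Fin n ⊕ Fin n) B) * basicProj B n *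
          star (z : Matrix (Fin n ⊕ Fin n) (Fin n ⊕ Fin n) B) ∧
      P.map (scalarPart (ClosedIdeal.toSubalgebra I)) = basicProj ℂ n ∧
      K0.incl k = K0Unital.mk P hP -
        K0Unital.mk (basicProj (Unitization ℂ (ClosedIdeal.toSubalgebra I)) n)
          (isStarProjection_basicProj _ n)

open Classical in
/-- The index map `δ : K₁(B/I) → K₀(I)`: `δ[u] = [z pₙ z*] - [pₙ]` for any unitary `u ∈ Mₙ(B/I)`
in the given class and any unitary lift `z ∈ M₂ₙ(B)` of `u ⊕ u*`. (Such `u` and `z` always exist,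
and the value does not depend on their choice.) -/
noncomputable def indexMap (x : K1 (B ⧸ I)) : K0 (ClosedIdeal.toSubalgebra I) :=
  if h : ∃ k : K0 (ClosedIdeal.toSubalgebra I),
      ∃ (n : ℕ) (u : unitary (Matrix (Fin n) (Fin n) (B ⧸ I))), K1.mk u = x ∧ IsIndex I u k
  then h.choose else 0

end Index

/-! ## Real rank zero, isometries -/

/-- `RR(A) = 0`: the invertible self-adjoint elements of the unitization `A⁺` are dense in the
self-adjoint elements of `A⁺`. (If `A` already has a unit, then `A⁺ ≅ A ⊕ ℂ`, and this holds if and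
only if the invertible self-adjoint elements of `A` are dense in the self-adjoint elements.) -/
def RealRankZero (A : Type*) [NonUnitalCStarAlgebra A] : Prop :=
  {a : Unitization ℂ A | IsSelfAdjoint a} ⊆
    closure {a : Unitization ℂ A | IsSelfAdjoint a ∧ IsUnit a}

/-- A proper isometry: `z*z = 1` and `zz* ≠ 1`. -/
def IsProperIsometry {A : Type*} [CStarAlgebra A] (z : A) : Prop :=
  star z * z = 1 ∧ z * star z ≠ 1

/-- A proper co-isometry: `zz* = 1` and `z*z ≠ 1`. -/
def IsProperCoisometry {A : Type*} [CStarAlgebra A] (z : A) : Prop :=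
  z * star z = 1 ∧ star z * z ≠ 1

end KTheory

/-!
Write `δ` for the index map. The statement follows from one formula and one injectivity result.

*The formula.* If a unitary `w` of `B/I` lifts to a partial isometry `v` of `B`, then the defect
projections `1 - v*v` and `1 - vv*` lie in `I`, the `2 × 2` matrix with rows `(v, 1 - vv*)` and
`(1 - v*v, v*)` is a unitary lift of `w ⊕ w*`, and it conjugates `1 ⊕ 0` to `vv* ⊕ (1 - v*v)`. Hence
`δ[w] = [1 - v*v] - [1 - vv*]` (`isIndex_of_partialIsometry`). For an isometry this is `-[1 - vv*]`,
and for a co-isometry it is `[1 - v*v]`. Real rank zero enters through an approximate unit of `I`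
that consists of projections (`RealRankZero.exists_isStarProjection_norm_sub_mul_le`), which makes
every unitary of `B/I` lift to a partial isometry (`RealRankZero.exists_partialIsometry_lift`).

*The injectivity.* The map `V(I) → K₀(I)` is injective (`RealRankZero.ofV_injective`). If
`[e] = [f]` in `K₀(I)`, then `e ⊕ 1` and `f ⊕ 1` are equivalent over the unitization. Cutting down
by a projection of the approximate unit turns this into an equivalence of `e ⊕ g` and `f ⊕ g` over `I`
(`RealRankZero.exists_mvN_fromBlocks`), and `[g]` cancels.

So a projection of `I` whose class in `K₀(I)` is zero is zero, which gives the strict inequalities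
for proper isometries and co-isometries. Conversely, an inequality between `δ[w]` and `0` becomes an
inequality in `V(I)` between the classes of the defect projections of `v`, and a partial isometry
of `I` that implements it extends `v` to an isometry or a co-isometry.

The value of `indexMap` is pinned down by showing that the index exists, does not depend on the
unitary lift, and is invariant under homotopy and stabilization (`IsIndex.indexMap_eq`). The lifts
needed for this are unitary parts of invertible lifts
(`exists_unitary_matrix_map_eq_of_isUnit`).
-/

/-! ### Inverse square roots and polar decomposition in C*-algebras -/

section InvSqrt

variable {A C : Type*} [CStarAlgebra A] [CStarAlgebra C]

/-- The inverse square root `y ^ (-1/2)` given by the continuous functional calculus. It is only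
meaningful when `y` is self-adjoint with strictly positive spectrum. -/
noncomputable def invSqrt (y : A) : A := cfc (fun t : ℝ => (√t)⁻¹) y

theorem isSelfAdjoint_invSqrt (y : A) : IsSelfAdjoint (invSqrt y) := cfc_predicate _ y

theorem Commute.invSqrt {y b : A} (h : Commute y b) : Commute (invSqrt y) b := h.cfc_real _

theorem continuousOn_inv_sqrt {y : A} (hpos : ∀ t ∈ spectrum ℝ y, 0 < t) :
    ContinuousOn (fun t : ℝ => (√t)⁻¹) (spectrum ℝ y) :=
  ContinuousOn.inv₀ (by fun_prop) fun t ht => (Real.sqrt_pos.2 (hpos t ht)).ne'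

theorem invSqrt_mul_mul_invSqrt {y : A} (hy : IsSelfAdjoint y)
    (hpos : ∀ t ∈ spectrum ℝ y, 0 < t) : invSqrt y * y * invSqrt y = 1 := by
  have hc := continuousOn_inv_sqrt hpos
  have h1 : invSqrt y * y * invSqrt y = cfc (fun t : ℝ => (√t)⁻¹ * t * (√t)⁻¹) y := by
    rw [cfc_mul (fun t : ℝ => (√t)⁻¹ * t) (fun t : ℝ => (√t)⁻¹) y (hc.mul continuousOn_id) hc,
      cfc_mul (fun t : ℝ => (√t)⁻¹) (fun t : ℝ => t) y hc continuousOn_id, cfc_id' ℝ y, invSqrt]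
  rw [h1, ← cfc_const_one ℝ y]
  refine cfc_congr fun t ht => ?_
  have h2 := Real.sqrt_pos.2 (hpos t ht)
  have h3 := Real.mul_self_sqrt (hpos t ht).le
  field_simp
  nlinarith

theorem map_invSqrt_of_map_eq_one (φ : A →⋆ₐ[ℂ] C) {y : A} (hy : IsSelfAdjoint y)
    (hpos : ∀ t ∈ spectrum ℝ y, 0 < t) (h1 : φ y = 1) : φ (invSqrt y) = 1 := by
  have hφ : Continuous φ := by
    open scoped CStarAlgebra in exact map_continuous φ
  have h := StarAlgHomClass.map_cfc (S := ℂ) φ (fun t : ℝ => (√t)⁻¹) y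
    (continuousOn_inv_sqrt hpos) hφ hy (by rw [h1]; exact .one C)
  rw [invSqrt, h, h1, cfc_apply_one]
  simp

theorem spectrum_star_mul_self_pos {x : A} (hx : IsUnit x) :
    ∀ t ∈ spectrum ℝ (star x * x), 0 < t := fun t ht =>
  lt_of_le_of_ne (spectrum_star_mul_self_nonneg t ht) fun h0 =>
    spectrum.zero_notMem ℝ (hx.star.mul hx) (h0 ▸ ht)

theorem spectrum_pos_of_norm_one_sub_lt_one {y : A} (hy : ‖1 - y‖ < 1) :
    ∀ t ∈ spectrum ℝ y, 0 < t := fun t ht => by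
  rcases subsingleton_or_nontrivial A with hA | hA
  · simp [spectrum.of_subsingleton] at ht
  have h1 : 1 - t ∈ spectrum ℝ (1 - y) := by
    have h2 := spectrum.singleton_sub_eq y (1 : ℝ)
    rw [map_one] at h2
    exact h2 ▸ ⟨1, rfl, t, ht, rfl⟩
  have h3 := (spectrum.norm_le_norm_of_mem h1).trans_lt hy
  rw [Real.norm_eq_abs, abs_lt] at h3
  linarith

/-- The unitary part of the polar decomposition of an invertible element. -/
theorem mul_invSqrt_mem_unitary {x : A} (hx : IsUnit x) :
    x * invSqrt (star x * x) ∈ unitary A := by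
  have hsa : IsSelfAdjoint (star x * x) := .star_mul_self x
  have h1 := invSqrt_mul_mul_invSqrt hsa (spectrum_star_mul_self_pos hx)
  have hcomm : Commute (invSqrt (star x * x)) (star x * x) :=
    Commute.invSqrt (Commute.refl (star x * x))
  have hr : IsUnit (invSqrt (star x * x)) := by
    refine isUnit_iff_exists_and_exists.2 ⟨⟨star x * x * invSqrt (star x * x), ?_⟩,
      ⟨invSqrt (star x * x) * (star x * x), h1⟩⟩
    rw [← mul_assoc, h1]
  have hz : star (x * invSqrt (star x * x)) * (x * invSqrt (star x * x)) = 1 := by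
    rw [star_mul, (isSelfAdjoint_invSqrt _).star_eq, ← h1]
    simp only [mul_assoc]
  refine Unitary.mem_iff.2 ⟨hz, ?_⟩
  obtain ⟨b, hb⟩ := (hx.mul hr).exists_right_inv
  have : star (x * invSqrt (star x * x)) = b := by
    rw [← mul_one (star _), ← hb, ← mul_assoc, hz, one_mul]
  rw [this, hb]

/-- If an invertible element is a lift of a unitary, then so is the unitary part of its polar
decomposition. -/
theorem exists_unitary_map_eq_of_isUnit (φ : A →⋆ₐ[ℂ] C) {x : A} (hx : IsUnit x)
    (hφ : φ x ∈ unitary C) : ∃ z ∈ unitary A, φ z = φ x :=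
  ⟨_, mul_invSqrt_mem_unitary hx, by
    rw [map_mul, map_invSqrt_of_map_eq_one φ (.star_mul_self x) (spectrum_star_mul_self_pos hx)
      (by rw [map_mul, map_star, Unitary.star_mul_self_of_mem hφ]), mul_one]⟩

/-- Projections at distance less than one are unitarily equivalent. -/
theorem exists_unitary_mul_eq_mul_of_norm_sub_lt_one {p q : A} (hp : IsStarProjection p)
    (hq : IsStarProjection q) (h : ‖p - q‖ < 1) : ∃ u ∈ unitary A, u * p = q * u := by
  have hp2 : p * p = p := hp.isIdempotentElem
  have hq2 : q * q = q := hq.isIdempotentElem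
  -- the invertible intertwiner between the two projections
  set x : A := q * p + (1 - q) * (1 - p) with hxdef
  have hxp : x * p = q * x := by
    simp only [hxdef, add_mul, mul_add, sub_mul, mul_sub, one_mul, mul_one, mul_assoc, hp2]
    simp only [← mul_assoc, hq2]
    abel
  have hpx : p * star x = star x * q := by
    have := congrArg star hxp
    rwa [star_mul, star_mul, hp.isSelfAdjoint.star_eq, hq.isSelfAdjoint.star_eq] at this
  have hu : (1 - 2 * q) ∈ unitary A := by
    have hs : star (1 - 2 * q) = 1 - 2 * q := by
      rw [star_sub, star_mul, hq.isSelfAdjoint.star_eq, star_one, star_ofNat, mul_two, two_mul]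
    have hm : (1 - 2 * q) * (1 - 2 * q) = 1 := by
      have : (1 - 2 * q) * (1 - 2 * q) = 1 - 4 * q + 4 * (q * q) := by noncomm_ring
      rw [this, hq2]
      abel
    exact Unitary.mem_iff.2 ⟨by rw [hs, hm], by rw [hs, hm]⟩
  have hx : IsUnit x := by
    have h1 : 1 - x = (1 - 2 * q) * (p - q) := by
      have : (1 - 2 * q) * (p - q) = p - q - 2 * (q * p) + 2 * (q * q) := by noncomm_ring
      rw [this, hq2, hxdef]
      noncomm_ring
    have h2 : ‖1 - x‖ < 1 := by
      rw [h1, CStarRing.norm_mem_unitary_mul _ hu]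
      exact h
    simpa using isUnit_one_sub_of_norm_lt_one h2
  refine ⟨_, mul_invSqrt_mem_unitary hx, ?_⟩
  have hc : Commute (star x * x) p := by
    change star x * x * p = p * (star x * x)
    rw [mul_assoc, hxp, ← mul_assoc, ← hpx, mul_assoc]
  rw [mul_assoc, (Commute.invSqrt hc).eq, ← mul_assoc, hxp, mul_assoc]

end InvSqrt

/-! ### Approximate units of projections, and lifting unitaries to partial isometries -/

namespace KTheory

section ApproximateUnit

variable {A : Type*} [NonUnitalCStarAlgebra A]

/-- The canonical character of the unitization as a unital *-homomorphism. -/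
def scalarPartHom (A : Type*) [NonUnitalCStarAlgebra A] : Unitization ℂ A →⋆ₐ[ℂ] ℂ :=
  { Unitization.fstHom ℂ A with map_star' := Unitization.fst_star }

theorem scalarPartHom_apply (x : Unitization ℂ A) : scalarPartHom A x = x.fst := rfl

open scoped CStarAlgebra in
theorem norm_fst_le (x : Unitization ℂ A) : ‖x.fst‖ ≤ ‖x‖ :=
  NonUnitalStarAlgHom.norm_apply_le (scalarPartHom A) x

/-- A C*-algebra of real rank zero has an approximate unit consisting of projections. Given
`a = ∑ xᵢ* xᵢ`, the projection is the spectral projection for `(0, ∞)` of an invertible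
self-adjoint element of the unitization that is close to `a - η`. -/
theorem RealRankZero.exists_isStarProjection_norm_sub_mul_le (hRR : RealRankZero A)
    {ι : Type*} [Fintype ι] (x : ι → A) {ε : ℝ} (hε : 0 < ε) :
    ∃ e : A, IsStarProjection e ∧ ∀ i, ‖x i - x i * e‖ ≤ ε := by
  let _ : PartialOrder (Unitization ℂ A) := CStarAlgebra.spectralOrder _
  have _ : StarOrderedRing (Unitization ℂ A) := CStarAlgebra.spectralOrderedRing _
  set a : Unitization ℂ A := ∑ i, star (x i : Unitization ℂ A) * (x i : Unitization ℂ A) with ha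
  have hale : ∀ i, star (x i : Unitization ℂ A) * (x i : Unitization ℂ A) ≤ a := fun i =>
    Finset.single_le_sum (f := fun i => star (x i : Unitization ℂ A) * (x i : Unitization ℂ A))
      (fun j _ => star_mul_self_nonneg _) (Finset.mem_univ i)
  have hasa : IsSelfAdjoint a := isSelfAdjoint_sum _ fun i _ => .star_mul_self _
  have hafst : a.fst = 0 := by
    rw [← scalarPartHom_apply, ha, map_sum]
    exact Finset.sum_eq_zero fun i _ => by
      rw [map_mul, scalarPartHom_apply (A := A) (x i : Unitization ℂ A), Unitization.fst_inr,
        mul_zero]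
  set η : ℝ := ε ^ 2 / 2 with hη
  have hη0 : 0 < η := by positivity
  have hcsa : IsSelfAdjoint (a - algebraMap ℝ (Unitization ℂ A) η) :=
    hasa.sub (.algebraMap _ (.all η))
  obtain ⟨b, ⟨hbsa, hbu⟩, hb⟩ := Metric.mem_closure_iff.1 (hRR hcsa) η hη0
  rw [dist_eq_norm] at hb
  set e : Unitization ℂ A := cfc (fun t : ℝ => if 0 < t then (1 : ℝ) else 0) b with he
  have hne : ∀ t ∈ spectrum ℝ b, t ≠ 0 := fun t ht h0 =>
    spectrum.zero_notMem ℝ hbu (h0 ▸ ht)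
  have hχ : ContinuousOn (fun t : ℝ => if 0 < t then (1 : ℝ) else 0) (spectrum ℝ b) := by
    intro t ht
    refine ContinuousAt.continuousWithinAt ?_
    rcases lt_or_gt_of_ne (hne t ht) with h | h
    · refine continuousAt_const.congr (f := fun _ => (0 : ℝ)) ?_
      filter_upwards [Iio_mem_nhds h] with s hs
      rw [if_neg (not_lt.2 (le_of_lt hs))]
    · refine continuousAt_const.congr (f := fun _ => (1 : ℝ)) ?_
      filter_upwards [Ioi_mem_nhds h] with s hs
      rw [if_pos (Set.mem_Ioi.1 hs)]
  have hesa : IsSelfAdjoint e := cfc_predicate _ b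
  have heid : e * e = e := by
    rw [he, ← cfc_mul _ _ b hχ hχ]
    refine cfc_congr fun t _ => ?_
    by_cases h : 0 < t <;> simp [h]
  have hefst : e.fst = 0 := by
    have h1 : scalarPartHom A e = cfc (fun t : ℝ => if 0 < t then (1 : ℝ) else 0)
        (scalarPartHom A b) := by
      refine StarAlgHomClass.map_cfc (S := ℂ) (scalarPartHom A) _ b hχ ?_ hbsa
        (hbsa.map (scalarPartHom A))
      open scoped CStarAlgebra in exact map_continuous (scalarPartHom A)
    have h2 : b.fst = algebraMap ℝ ℂ b.fst.re := by
      have : star b.fst = b.fst := by rw [← Unitization.fst_star, hbsa.star_eq]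
      exact (Complex.conj_eq_iff_re.1 this).symm
    have h3 : b.fst.re < 0 := by
      have h4 := (norm_fst_le (a - algebraMap ℝ (Unitization ℂ A) η - b)).trans_lt hb
      have h5 : (algebraMap ℝ (Unitization ℂ A) η).fst = (η : ℂ) := by
        rw [← scalarPartHom_apply, IsScalarTower.algebraMap_apply ℝ ℂ (Unitization ℂ A),
          AlgHomClass.commutes]
        rfl
      rw [← scalarPartHom_apply, map_sub, map_sub, scalarPartHom_apply, scalarPartHom_apply,
        scalarPartHom_apply, hafst, h5] at h4
      have h6 := (abs_lt.1 ((Complex.abs_re_le_norm _).trans_lt h4)).1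
      simp only [zero_sub, Complex.sub_re, Complex.neg_re, Complex.ofReal_re] at h6
      linarith
    rw [← scalarPartHom_apply, h1, scalarPartHom_apply, h2, cfc_algebraMap]
    simp [h3.le]
  have hmain : (1 - e) * a * (1 - e) ≤ algebraMap ℝ _ (2 * η) := by
    have h1sa : IsSelfAdjoint (1 - e) := (IsSelfAdjoint.one _).sub hesa
    have h1 : a ≤ b + algebraMap ℝ _ (2 * η) := by
      have h2 : a - algebraMap ℝ _ η - b ≤ algebraMap ℝ _ η :=
        ((hcsa.sub hbsa).le_algebraMap_norm_self).trans (algebraMap_mono _ hb.le)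
      rw [two_mul, map_add, ← add_assoc]
      rw [sub_sub, sub_le_iff_le_add] at h2
      rwa [add_comm, add_comm (algebraMap ℝ _ η) b] at h2
    have h2 : (1 - e) * b * (1 - e) ≤ 0 := by
      have h3 : (1 - e) * b * (1 - e) = cfc (fun t : ℝ => (1 - if 0 < t then (1 : ℝ) else 0) * t *
          (1 - if 0 < t then (1 : ℝ) else 0)) b := by
        have hc : ContinuousOn (fun t : ℝ => 1 - if 0 < t then (1 : ℝ) else 0) (spectrum ℝ b) :=
          continuousOn_const.sub hχ
        rw [cfc_mul (fun t : ℝ => (1 - if 0 < t then (1 : ℝ) else 0) * t)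
          (fun t : ℝ => 1 - if 0 < t then (1 : ℝ) else 0) b (hc.mul continuousOn_id) hc,
          cfc_mul (fun t : ℝ => 1 - if 0 < t then (1 : ℝ) else 0) (fun t : ℝ => t) b hc
          continuousOn_id, cfc_id' ℝ b,
          cfc_sub (fun _ : ℝ => (1 : ℝ)) _ b continuousOn_const hχ, cfc_const_one ℝ b]
      rw [h3]
      refine cfc_nonpos _ b fun t _ => ?_
      by_cases h : 0 < t
      · simp [h]
      · simpa [h] using not_lt.1 h
    have h3 : (1 - e) * algebraMap ℝ _ (2 * η) * (1 - e) ≤ algebraMap ℝ _ (2 * η) := by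
      rw [← Algebra.commutes, mul_assoc]
      have h4 : (1 - e) * (1 - e) = 1 - e := by
        rw [mul_sub, mul_one, sub_mul, one_mul, heid, sub_self, sub_zero]
      rw [h4, mul_sub, mul_one, sub_le_self_iff, ← Algebra.smul_def]
      refine smul_nonneg (by positivity) ?_
      have : e = star e * e := by rw [hesa.star_eq, heid]
      rw [this]
      exact star_mul_self_nonneg e
    calc (1 - e) * a * (1 - e) ≤ (1 - e) * (b + algebraMap ℝ _ (2 * η)) * (1 - e) :=
          h1sa.conjugate_le_conjugate h1
      _ = (1 - e) * b * (1 - e) + (1 - e) * algebraMap ℝ _ (2 * η) * (1 - e) := by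
          rw [mul_add, add_mul]
      _ ≤ 0 + algebraMap ℝ _ (2 * η) := add_le_add h2 h3
      _ = _ := zero_add _
  have heinr : e = (e.snd : Unitization ℂ A) := by
    ext
    · rw [hefst, Unitization.fst_inr]
    · rw [Unitization.snd_inr]
  refine ⟨e.snd, ⟨?_, ?_⟩, fun i => ?_⟩
  · refine Unitization.inr_injective (R := ℂ) ?_
    rw [Unitization.inr_mul, ← heinr, heid]
  · refine Unitization.inr_injective (R := ℂ) ?_
    rw [Unitization.inr_star, ← heinr, hesa.star_eq]
  · have h1 : ((x i - x i * e.snd : A) : Unitization ℂ A) = (x i : Unitization ℂ A) * (1 - e) := by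
      rw [Unitization.inr_sub, Unitization.inr_mul, ← heinr, mul_sub, mul_one]
    rw [← Unitization.norm_inr (𝕜 := ℂ), h1]
    have h1sa : IsSelfAdjoint (1 - e) := (IsSelfAdjoint.one _).sub hesa
    have h2 : star ((x i : Unitization ℂ A) * (1 - e)) * ((x i : Unitization ℂ A) * (1 - e)) ≤
        algebraMap ℝ _ (2 * η) := by
      refine le_trans ?_ hmain
      rw [star_mul, h1sa.star_eq]
      have := h1sa.conjugate_le_conjugate (hale i)
      simpa only [mul_assoc] using this
    have h3 := (CStarAlgebra.norm_le_iff_le_algebraMap _ (by positivity)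
      (star_mul_self_nonneg _)).2 h2
    rw [CStarRing.norm_star_mul_self, hη] at h3
    exact abs_le_of_sq_le_sq' (by nlinarith) hε.le |>.2

end ApproximateUnit

section PartialIsometry

variable {B : Type*} [CStarAlgebra B] (I : Ideal B) [I.IsTwoSided] [IsClosed (I : Set B)]

/-- The quotient map `B → B/I` as a *-homomorphism. -/
noncomputable def quotientHom : B →⋆ₐ[ℂ] B ⧸ I where
  toFun := Ideal.Quotient.mk I
  map_one' := map_one _
  map_mul' := map_mul _
  map_zero' := map_zero _
  map_add' := map_add _
  commutes' _ := rfl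
  map_star' _ := rfl

theorem quotientHom_surjective : Function.Surjective (quotientHom I) :=
  Ideal.Quotient.mk_surjective

theorem quotientHom_eq_zero_iff {b : B} : quotientHom I b = 0 ↔ b ∈ I :=
  Ideal.Quotient.eq_zero_iff_mem

theorem quotientHom_coe (x : ClosedIdeal.toSubalgebra I) : quotientHom I (x : B) = 0 :=
  (quotientHom_eq_zero_iff I).2 x.2

theorem isStarProjection_mul_star_self {A : Type*} [CStarAlgebra A] {v : A}
    (h : IsStarProjection (star v * v)) : IsStarProjection (v * star v) :=
  ⟨isIdempotentElem_star_mul_self_iff_isIdempotentElem_self_mul_star.1 h.isIdempotentElem,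
    .mul_star_self v⟩

/-- If `I` has real rank zero, every unitary of `B/I` lifts to a partial isometry of `B`: cut an
arbitrary lift `a` down by `1 - e`, where `e` is a projection of `I` with `(1 - a*a)(1 - e)` small,
and take the polar decomposition. -/
theorem RealRankZero.exists_partialIsometry_lift
    (hRR : RealRankZero (ClosedIdeal.toSubalgebra I)) (w : unitary (B ⧸ I)) :
    ∃ v : B, IsStarProjection (star v * v) ∧ quotientHom I v = (w : B ⧸ I) := by
  obtain ⟨a, ha⟩ := quotientHom_surjective I (w : B ⧸ I)
  have hk : 1 - star a * a ∈ I := by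
    rw [← quotientHom_eq_zero_iff, map_sub, map_one, map_mul, map_star, ha,
      Unitary.coe_star_mul_self, sub_self]
  obtain ⟨e', he', hsmall⟩ := hRR.exists_isStarProjection_norm_sub_mul_le
    (fun _ : Unit => (⟨1 - star a * a, hk⟩ : ClosedIdeal.toSubalgebra I)) one_half_pos
  set e : B := (e' : B) with hedef
  have hesa : star e = e := congrArg Subtype.val he'.isSelfAdjoint.star_eq
  have heid : e * e = e := congrArg Subtype.val he'.isIdempotentElem.eq
  have hπe : quotientHom I e = 0 := quotientHom_coe I e'
  have hsmall' : ‖(1 - star a * a) * (1 - e)‖ ≤ 1 / 2 := by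
    have := hsmall ()
    rwa [mul_sub, mul_one]
  have hp : IsStarProjection (1 - e) :=
    IsStarProjection.one_sub ⟨heid, hesa⟩
  have hp2 : (1 - e) * (1 - e) = 1 - e := hp.isIdempotentElem
  have hps : star (1 - e) = 1 - e := hp.isSelfAdjoint
  have hpe : (1 - e) * e = 0 := by rw [sub_mul, one_mul, heid, sub_self]
  have hep : e * (1 - e) = 0 := by rw [mul_sub, mul_one, heid, sub_self]
  set y : B := (1 - e) * (star a * a) * (1 - e) + e with hy
  have hysa : IsSelfAdjoint y := by
    rw [hy, isSelfAdjoint_iff, star_add, star_mul, star_mul, hps, hesa, star_mul, star_star]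
    simp only [mul_assoc]
  have hy1 : 1 - y = (1 - e) * ((1 - star a * a) * (1 - e)) := by
    have : (1 - e) * ((1 - star a * a) * (1 - e)) =
      (1 - e) * (1 - e) - (1 - e) * (star a * a) * (1 - e) := by noncomm_ring
    rw [this, hp2, hy]
    abel
  have hnorm : ‖1 - y‖ < 1 := by
    have h1 : ‖1 - e‖ ≤ 1 := hp.norm_le
    rw [hy1]
    refine (norm_mul_le _ _).trans_lt ?_
    nlinarith [norm_nonneg (1 - e), norm_nonneg ((1 - star a * a) * (1 - e))]
  have hpos := spectrum_pos_of_norm_one_sub_lt_one hnorm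
  have hyp : y * (1 - e) = (1 - e) * (star a * a) * (1 - e) := by
    rw [hy, add_mul, mul_assoc _ (1 - e) (1 - e), hp2, hep, add_zero]
  have hpy : (1 - e) * y = (1 - e) * (star a * a) * (1 - e) := by
    rw [hy, mul_add, ← mul_assoc, ← mul_assoc, hp2, hpe, add_zero]
  have hcomm : Commute y (1 - e) := by rw [commute_iff_eq, hyp, hpy]
  have hrc : invSqrt y * (1 - e) = (1 - e) * invSqrt y := hcomm.invSqrt.eq
  refine ⟨a * (1 - e) * invSqrt y, ?_, ?_⟩
  · have h1 : star (a * (1 - e) * invSqrt y) * (a * (1 - e) * invSqrt y) = 1 - e := by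
      calc star (a * (1 - e) * invSqrt y) * (a * (1 - e) * invSqrt y)
          = invSqrt y * ((1 - e) * (star a * a) * (1 - e)) * invSqrt y := by
            rw [star_mul, star_mul, hps, (isSelfAdjoint_invSqrt y).star_eq]
            simp only [mul_assoc]
        _ = invSqrt y * y * invSqrt y * (1 - e) := by
            rw [← hyp, mul_assoc _ (invSqrt y) (1 - e), hrc]
            simp only [mul_assoc]
        _ = 1 - e := by rw [invSqrt_mul_mul_invSqrt hysa hpos, one_mul]
    rw [h1]
    exact hp
  · have h1 : quotientHom I y = 1 := by
      rw [hy, map_add, map_mul, map_mul, map_mul, map_star, map_sub, map_one, hπe, ha,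
        Unitary.coe_star_mul_self]
      simp
    rw [map_mul, map_mul, map_sub, map_one, hπe, ha, map_invSqrt_of_map_eq_one _ hysa hpos h1]
    simp

end PartialIsometry

end KTheory

/-! ### Lifting unitary matrices along surjections of C*-algebras -/

namespace KTheory

open Matrix

theorem star_fromBlocks {R N : Type*} [AddMonoid R] [StarAddMonoid R] (a b c d : Matrix N N R) :
    star (fromBlocks a b c d) = fromBlocks (star a) (star c) (star b) (star d) :=
  fromBlocks_conjTranspose ..

section MatrixLift

variable {A C : Type*} [CStarAlgebra A] [CStarAlgebra C] {N : Type*} [Fintype N] [DecidableEq N]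

/-- The entrywise application of a *-homomorphism, as a *-homomorphism of the C*-algebras of
matrices. -/
def cstarMatrixMap (N : Type*) [Fintype N] [DecidableEq N] (φ : A →⋆ₐ[ℂ] C) :
    CStarMatrix N N A →⋆ₐ[ℂ] CStarMatrix N N C where
  toFun x := x.map φ
  map_one' := Matrix.map_one φ (map_zero φ) (map_one φ)
  map_mul' _ _ := Matrix.map_mul
  map_zero' := Matrix.map_zero φ (map_zero φ)
  map_add' := Matrix.map_add φ (map_add φ)
  commutes' r := by
    ext i j
    simp only [CStarMatrix.map_apply, CStarMatrix.algebraMap_apply]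
    split_ifs
    · exact AlgHomClass.commutes φ r
    · exact map_zero φ
  map_star' x := (Matrix.conjTranspose_map φ (map_star φ) : (x : Matrix N N A)ᴴ.map φ = _)

/-- The polar decomposition turns an invertible lift of a unitary matrix into a unitary lift. -/
theorem exists_unitary_matrix_map_eq_of_isUnit (φ : A →⋆ₐ[ℂ] C) {x : Matrix N N A}
    (hx : IsUnit x) (hφ : x.map φ ∈ unitary (Matrix N N C)) :
    ∃ z ∈ unitary (Matrix N N A), z.map φ = x.map φ := by
  let _ : PartialOrder A := CStarAlgebra.spectralOrder _
  have _ : StarOrderedRing A := CStarAlgebra.spectralOrderedRing _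
  let _ : PartialOrder C := CStarAlgebra.spectralOrder _
  have _ : StarOrderedRing C := CStarAlgebra.spectralOrderedRing _
  exact exists_unitary_map_eq_of_isUnit (A := CStarMatrix N N A) (C := CStarMatrix N N C)
    (cstarMatrixMap N φ) (x := CStarMatrix.ofMatrix x) hx hφ

/-- For a unitary matrix `u` over a quotient, `u ⊕ u*` is a product of elementary matrices, and so
it lifts to an invertible and hence to a unitary matrix. -/
theorem exists_unitary_matrix_map_eq_fromBlocks {φ : A →⋆ₐ[ℂ] C} (hφ : Function.Surjective φ)
    {u : Matrix N N C} (hu : u ∈ unitary (Matrix N N C)) :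
    ∃ z ∈ unitary (Matrix (N ⊕ N) (N ⊕ N) A), z.map φ = fromBlocks u 0 0 (star u) := by
  obtain ⟨a, ha⟩ : ∃ a : Matrix N N A, a.map φ = u :=
    ⟨u.map (Function.surjInv hφ), by ext; simp [Function.surjInv_eq hφ]⟩
  obtain ⟨c, hc⟩ : ∃ c : Matrix N N A, c.map φ = star u :=
    ⟨(star u).map (Function.surjInv hφ), by ext; simp [Function.surjInv_eq hφ]⟩
  have huu := Unitary.mul_star_self_of_mem hu
  have huu' := Unitary.star_mul_self_of_mem hu
  have h1 : IsUnit (fromBlocks 1 a 0 1 : Matrix (N ⊕ N) (N ⊕ N) A) :=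
    isUnit_iff_exists.2 ⟨fromBlocks 1 (-a) 0 1,
      by simp [fromBlocks_multiply], by simp [fromBlocks_multiply]⟩
  have h2 : IsUnit (fromBlocks 1 0 (-c) 1 : Matrix (N ⊕ N) (N ⊕ N) A) :=
    isUnit_iff_exists.2 ⟨fromBlocks 1 0 c 1,
      by simp [fromBlocks_multiply], by simp [fromBlocks_multiply]⟩
  have h3 : IsUnit (fromBlocks 0 (-1) 1 0 : Matrix (N ⊕ N) (N ⊕ N) A) :=
    isUnit_iff_exists.2 ⟨fromBlocks 0 1 (-1) 0,
      by simp [fromBlocks_multiply], by simp [fromBlocks_multiply]⟩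
  have hmap : (fromBlocks 1 a 0 1 * fromBlocks 1 0 (-c) 1 * fromBlocks 1 a 0 1 *
      fromBlocks 0 (-1) 1 0 : Matrix (N ⊕ N) (N ⊕ N) A).map φ = fromBlocks u 0 0 (star u) := by
    have hneg : ∀ M : Matrix N N A, (-M).map φ = -(M.map φ) := fun M => by ext; simp
    have h1 : (1 : Matrix N N A).map φ = 1 := Matrix.map_one φ (map_zero φ) (map_one φ)
    have h0 : (0 : Matrix N N A).map φ = 0 := Matrix.map_zero φ (map_zero φ)
    rw [Matrix.map_mul, Matrix.map_mul, Matrix.map_mul]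
    simp only [fromBlocks_map, ha, hc, hneg, h1, h0, fromBlocks_multiply]
    simp [huu, huu']
  obtain ⟨z, hz, hz'⟩ := exists_unitary_matrix_map_eq_of_isUnit φ (((h1.mul h2).mul h1).mul h3)
    (by
      rw [hmap, Unitary.mem_iff, star_fromBlocks, fromBlocks_multiply, fromBlocks_multiply,
        star_star]
      simp [huu, huu'])
  exact ⟨z, hz, hz'.trans hmap⟩

theorem setOf_isUnit_mem_nhds_one_matrix :
    {x : Matrix N N A | IsUnit x} ∈ nhds (1 : Matrix N N A) := by
  let _ : PartialOrder A := CStarAlgebra.spectralOrder _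
  have _ : StarOrderedRing A := CStarAlgebra.spectralOrderedRing _
  exact Units.nhds (R := CStarMatrix N N A) 1

theorem isOpenMap_matrix_map {φ : A →⋆ₐ[ℂ] C} (hφ : Function.Surjective φ) :
    IsOpenMap (fun x : Matrix N N A => x.map φ) := by
  let _ : PartialOrder A := CStarAlgebra.spectralOrder _
  have _ : StarOrderedRing A := CStarAlgebra.spectralOrderedRing _
  let _ : PartialOrder C := CStarAlgebra.spectralOrder _
  have _ : StarOrderedRing C := CStarAlgebra.spectralOrderedRing _
  have hcont : Continuous (cstarMatrixMap N φ) := by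
    open scoped CStarAlgebra in exact map_continuous (cstarMatrixMap N φ)
  let f : CStarMatrix N N A →L[ℂ] CStarMatrix N N C :=
    ⟨(cstarMatrixMap N φ).toAlgHom.toLinearMap, hcont⟩
  have hf : Function.Surjective f := fun u =>
    ⟨CStarMatrix.map u (Function.surjInv hφ), by
      ext i j
      exact Function.surjInv_eq hφ (u i j)⟩
  exact f.isOpenMap hf

/-- If two unitary matrices over a quotient are homotopic, then `u⁻¹v` has a unitary lift: the
unitaries that lift form an open, hence closed, subgroup. -/
theorem exists_unitary_matrix_map_eq_of_joined {φ : A →⋆ₐ[ℂ] C} (hφ : Function.Surjective φ)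
    {u v : unitary (Matrix N N C)} (h : Joined u v) :
    ∃ a ∈ unitary (Matrix N N A), a.map φ = star (u : Matrix N N C) * v := by
  let S : Subgroup (unitary (Matrix N N C)) :=
    { carrier := {c | ∃ a ∈ unitary (Matrix N N A), a.map φ = c}
      one_mem' := ⟨1, one_mem _, Matrix.map_one φ (map_zero φ) (map_one φ)⟩
      mul_mem' := by
        rintro c d ⟨a, ha, hac⟩ ⟨b, hb, hbd⟩
        exact ⟨a * b, mul_mem ha hb, by rw [Matrix.map_mul, hac, hbd]; rfl⟩
      inv_mem' := by
        rintro c ⟨a, ha, hac⟩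
        refine ⟨star a, Unitary.star_mem ha, ?_⟩
        rw [star_eq_conjTranspose, conjTranspose_map φ (map_star φ), hac]
        rfl }
  have hopen : IsOpen (S : Set (unitary (Matrix N N C))) := by
    refine Subgroup.isOpen_of_mem_nhds S (g := 1) ?_
    have h1 := (isOpenMap_matrix_map hφ).image_mem_nhds
      (setOf_isUnit_mem_nhds_one_matrix (A := A) (N := N))
    rw [Matrix.map_one φ (map_zero φ) (map_one φ)] at h1
    have h2 : Continuous (Subtype.val : unitary (Matrix N N C) → Matrix N N C) :=
      continuous_subtype_val
    filter_upwards [h2.continuousAt.preimage_mem_nhds (x := 1) h1]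
    rintro c ⟨x, hx, hxc⟩
    obtain ⟨z, hz, hz'⟩ := exists_unitary_matrix_map_eq_of_isUnit φ hx
      (by rw [show x.map φ = c from hxc]; exact c.2)
    exact ⟨z, hz, hz'.trans hxc⟩
  have hclopen : IsClopen ((fun x => u⁻¹ * x) ⁻¹' (S : Set (unitary (Matrix N N C)))) :=
    IsClopen.preimage ⟨S.isClosed_of_isOpen hopen, hopen⟩ (continuous_const_mul _)
  have hv : v ∈ connectedComponent u := pathComponent_subset_component u h
  exact hclopen.connectedComponent_subset (by simp) hv

end MatrixLift

end KTheory

/-! ### Cancellation in `V(A⁺)` and injectivity of `V(A) → K₀(A)` -/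

namespace KTheory

open Matrix

section AbstractEstimates

variable {D : Type*} [CStarAlgebra D]

/-- If `v` is isometric on the range of `p` and `v p v*` is close to a projection `q`, then `p` and
`q` are Murray-von Neumann equivalent through an element of `D p`. -/
theorem exists_mul_eq_of_norm_conj_sub_lt_one {v p q : D} (hp : IsStarProjection p)
    (hq : IsStarProjection q) (hv : star v * v * p = p) (h : ‖v * p * star v - q‖ < 1) :
    ∃ u : D, star (u * p) * (u * p) = p ∧ u * p * star (u * p) = q := by
  have hp2 : p * p = p := hp.isIdempotentElem
  have hq2 : q * q = q := hq.isIdempotentElem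
  have hps : star p = p := hp.isSelfAdjoint
  have hproj : IsStarProjection (v * p * star v) := by
    refine ⟨?_, ?_⟩
    · calc v * p * star v * (v * p * star v) = v * p * (star v * v * p) * star v := by
            simp only [mul_assoc]
        _ = v * p * star v := by rw [hv, mul_assoc v p p, hp2]
    · rw [isSelfAdjoint_iff, star_mul, star_mul, star_star, hps, mul_assoc]
  obtain ⟨u, hu, huq⟩ := exists_unitary_mul_eq_mul_of_norm_sub_lt_one hproj hq h
  have hu1 := Unitary.star_mul_self_of_mem hu
  have hu2 := Unitary.mul_star_self_of_mem hu
  refine ⟨u * v, ?_, ?_⟩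
  · calc star (u * v * p) * (u * v * p) = p * star v * (star u * u) * v * p := by
          rw [star_mul, star_mul, hps]; simp only [mul_assoc]
      _ = p * (star v * v * p) := by rw [hu1]; simp only [mul_assoc, one_mul]
      _ = p := by rw [hv, hp2]
  · calc u * v * p * star (u * v * p) = u * (v * (p * p) * star v) * star u := by
          rw [star_mul, star_mul, hps]; simp only [mul_assoc]
      _ = q := by rw [hp2, huq, mul_assoc, hu2, mul_one]

theorem norm_conj_sub_lt_one {v x E H : D} (hE : IsStarProjection E) (hH : IsStarProjection H)
    (h1 : star v * v = E) (h2 : v * star v = E) (hHv : H * v = v * H)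
    (hHE : H * E = E * H) (hx : ‖x * H‖ < 1 / 4) :
    ‖(v + x) * (E * H) * star (v + x) - E * H‖ < 1 := by
  have hE2 : E * E = E := hE.isIdempotentElem
  have hH2 : H * H = H := hH.isIdempotentElem
  have hHs : star H = H := hH.isSelfAdjoint
  have hHv' : star v * H = H * star v := by
    have := congrArg star hHv
    rwa [star_mul, star_mul, hHs] at this
  have hv1 : ‖v * H‖ ≤ 1 := by
    have h3 : ‖v‖ * ‖v‖ ≤ 1 := by
      rw [← CStarRing.norm_star_mul_self, h1]
      exact hE.norm_le
    have h4 : ‖v‖ ≤ 1 := by nlinarith [norm_nonneg v]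
    calc ‖v * H‖ ≤ ‖v‖ * ‖H‖ := norm_mul_le _ _
      _ ≤ 1 * 1 := mul_le_mul h4 hH.norm_le (norm_nonneg _) zero_le_one
      _ = 1 := one_mul 1
  have hHEH : E * H = H * E * H := by rw [hHE, mul_assoc, hH2]
  have hmain : v * (E * H) * star v = E * H := by
    calc v * (E * H) * star v = v * E * star v * H := by
          rw [mul_assoc, mul_assoc E, ← hHv']; simp only [mul_assoc]
      _ = v * star v * (v * star v) * H := by rw [← h1]; simp only [mul_assoc]
      _ = E * H := by rw [h2, hE2]
  have hsplit : (v + x) * (E * H) * star (v + x) - E * H =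
      (x * H) * E * star (v * H) + (v * H) * E * star (x * H) + (x * H) * E * star (x * H) := by
    have : (v + x) * (E * H) * star (v + x) - E * H =
        x * (E * H) * star v + v * (E * H) * star x + x * (E * H) * star x := by
      rw [star_add, add_mul, add_mul, mul_add, mul_add, hmain]
      abel
    rw [this, hHEH, star_mul, star_mul, hHs]
    simp only [mul_assoc]
  have hbound : ∀ s t : D, ‖s * E * star t‖ ≤ ‖s‖ * ‖t‖ := fun s t => by
    calc ‖s * E * star t‖ ≤ ‖s‖ * ‖E‖ * ‖star t‖ :=
          (norm_mul_le _ _).trans (mul_le_mul_of_nonneg_right (norm_mul_le _ _) (norm_nonneg _))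
      _ ≤ ‖s‖ * 1 * ‖t‖ := by
          rw [norm_star]
          have := hE.norm_le
          gcongr
      _ = ‖s‖ * ‖t‖ := by rw [mul_one]
  rw [hsplit]
  have h5 := norm_nonneg (x * H)
  calc _ ≤ ‖x * H‖ * ‖v * H‖ + ‖v * H‖ * ‖x * H‖ + ‖x * H‖ * ‖x * H‖ :=
        (norm_add_le _ _).trans (add_le_add ((norm_add_le _ _).trans
          (add_le_add (hbound _ _) (hbound _ _))) (hbound _ _))
    _ < 1 := by nlinarith

end AbstractEstimates

section Injectivity

variable {A : Type*} [NonUnitalCStarAlgebra A]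

/-- The *-endomorphism `(λ, a) ↦ (λ, 0)` of the unitization. -/
noncomputable def scalarEnd (A : Type*) [NonUnitalCStarAlgebra A] :
    Unitization ℂ A →⋆ₐ[ℂ] Unitization ℂ A :=
  (StarAlgHom.ofId ℂ (Unitization ℂ A)).comp (scalarPartHom A)

theorem scalarEnd_apply (x : Unitization ℂ A) :
    scalarEnd A x = algebraMap ℂ (Unitization ℂ A) x.fst := rfl

theorem scalarEnd_inr (a : A) : scalarEnd A (a : Unitization ℂ A) = 0 := by
  rw [scalarEnd_apply, Unitization.fst_inr, map_zero]

theorem map_unitizationInr_injective {ι κ : Type*} :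
    Function.Injective fun M : Matrix ι κ A => M.map (unitizationInr A) :=
  Matrix.map_injective Unitization.inr_injective

theorem exists_norm_lt_of_forall_norm_entry_le {U : Type*} [CStarAlgebra U] [PartialOrder U]
    [StarOrderedRing U] (N : Type*) [Fintype N] {ε : ℝ} (hε : 0 < ε) :
    ∃ δ > 0, ∀ M : CStarMatrix N N U, (∀ i j, ‖M i j‖ ≤ δ) → ‖M‖ < ε := by
  have h : {M : CStarMatrix N N U | ‖M‖ < ε} ∈ nhds (0 : CStarMatrix N N U) :=
    (isOpen_lt continuous_norm continuous_const).mem_nhds (by simpa using hε)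
  have h' : {M : N → N → U | ‖(CStarMatrix.ofMatrix (Matrix.of M) : CStarMatrix N N U)‖ < ε} ∈
      nhds (0 : N → N → U) := h
  obtain ⟨δ, hδ, hsub⟩ := Metric.mem_nhds_iff.1 h'
  refine ⟨δ / 2, half_pos hδ, fun M hM => hsub ?_⟩
  refine mem_ball_zero_iff.2 ?_
  refine ((pi_norm_le_iff_of_nonneg (half_pos hδ).le).2 fun i =>
    (pi_norm_le_iff_of_nonneg (half_pos hδ).le).2 fun j => ?_).trans_lt (half_lt_self hδ)
  exact hM i j

/-- If `e ⊕ 1` and `f ⊕ 1` are equivalent over the unitization, then `e ⊕ g` and `f ⊕ g` are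
equivalent over `A` for some `g`: if `v` implements the first equivalence and `1 - g` is a
projection that almost annihilates the non-scalar part of `v`, then `v (e ⊕ g) v*` is close
to `f ⊕ g`. -/
theorem RealRankZero.exists_mvN_fromBlocks (hRR : RealRankZero A) {ι κ : Type*} [Fintype ι]
    [Fintype κ] [DecidableEq ι] [DecidableEq κ] {e f : Matrix ι ι A} (he : IsStarProjection e)
    (hf : IsStarProjection f)
    (h : MvN (fromBlocks (e.map (unitizationInr A)) 0 0 (1 : Matrix κ κ (Unitization ℂ A)))
      (fromBlocks (f.map (unitizationInr A)) 0 0 (1 : Matrix κ κ (Unitization ℂ A)))) :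
    ∃ g : Matrix κ κ A, IsStarProjection g ∧ MvN (fromBlocks e 0 0 g) (fromBlocks f 0 0 g) := by
  let _ : PartialOrder (Unitization ℂ A) := CStarAlgebra.spectralOrder _
  have _ : StarOrderedRing (Unitization ℂ A) := CStarAlgebra.spectralOrderedRing _
  obtain ⟨v, hv1, hv2⟩ := h
  obtain ⟨δ, hδ, hδ'⟩ := exists_norm_lt_of_forall_norm_entry_le (U := Unitization ℂ A) (ι ⊕ κ)
    (ε := 1 / 4) (by norm_num)
  obtain ⟨g₀, hg₀, hsmall⟩ := hRR.exists_isStarProjection_norm_sub_mul_le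
    (fun ij : (ι ⊕ κ) × (ι ⊕ κ) => (v ij.1 ij.2).snd) hδ
  have hg₀s : star g₀ = g₀ := hg₀.isSelfAdjoint
  have hg₀2 : g₀ * g₀ = g₀ := hg₀.isIdempotentElem
  set g : Matrix κ κ A := diagonal fun _ => g₀ with hgdef
  have hg : IsStarProjection g := by
    refine ⟨?_, ?_⟩
    · change g * g = g
      rw [hgdef, diagonal_mul_diagonal, hg₀2]
    · change gᴴ = g
      rw [hgdef, diagonal_conjTranspose]
      exact congrArg diagonal (funext fun _ => hg₀s)
  refine ⟨g, hg, ?_⟩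
  have hp := isStarProjection_fromBlocks he hg
  have hq := isStarProjection_fromBlocks hf hg
  -- `H` is `1 - g₀` on the diagonal, which commutes with the scalar matrices
  set h₀ : Unitization ℂ A := 1 - (g₀ : Unitization ℂ A) with hh₀
  have hh₀p : IsStarProjection h₀ := IsStarProjection.one_sub
    ⟨by rw [IsIdempotentElem, ← Unitization.inr_mul, hg₀2],
      by rw [isSelfAdjoint_iff, ← Unitization.inr_star, hg₀s]⟩
  have hh₀s : star h₀ = h₀ := hh₀p.isSelfAdjoint
  have hh₀2 : h₀ * h₀ = h₀ := hh₀p.isIdempotentElem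
  set H : Matrix (ι ⊕ κ) (ι ⊕ κ) (Unitization ℂ A) := diagonal fun _ => h₀ with hHdef
  set E : Matrix (ι ⊕ κ) (ι ⊕ κ) (Unitization ℂ A) := fromBlocks 0 0 0 1 with hEdef
  have hE : IsStarProjection E := isStarProjection_fromBlocks (.zero _) (.one _)
  have hH : IsStarProjection H := by
    refine ⟨?_, ?_⟩
    · change H * H = H
      rw [hHdef, diagonal_mul_diagonal, hh₀2]
    · change Hᴴ = H
      rw [hHdef, diagonal_conjTranspose]
      exact congrArg diagonal (funext fun _ => hh₀s)
  set v₀ : Matrix (ι ⊕ κ) (ι ⊕ κ) (Unitization ℂ A) := v.map (scalarEnd A) with hv₀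
  have hscalar : ∀ M : Matrix ι ι A, (fromBlocks (M.map (unitizationInr A)) 0 0
      (1 : Matrix κ κ (Unitization ℂ A))).map (scalarEnd A) = E := fun M => by
    have h0 : (M.map (unitizationInr A)).map (scalarEnd A) = 0 := by
      ext1 i j
      exact scalarEnd_inr (M i j)
    rw [fromBlocks_map, h0, Matrix.map_one _ (map_zero _) (map_one _), hEdef]
    simp [Matrix.map_zero]
  have hv₀1 : star v₀ * v₀ = E := by
    rw [star_eq_conjTranspose, hv₀, ← conjTranspose_map _ (map_star (scalarEnd A)),
      ← Matrix.map_mul, hv1, hscalar]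
  have hv₀2 : v₀ * star v₀ = E := by
    rw [star_eq_conjTranspose, hv₀, ← conjTranspose_map _ (map_star (scalarEnd A)),
      ← Matrix.map_mul, hv2, hscalar]
  have hHv : H * v₀ = v₀ * H := by
    ext1 i j
    rw [hHdef, diagonal_mul, mul_diagonal, hv₀, Matrix.map_apply, scalarEnd_apply]
    exact (Algebra.commutes _ _).symm
  have hEH : E * H = fromBlocks 0 0 0 (diagonal fun _ => h₀) := by
    ext1 (i | i) (j | j) <;>
      simp [hHdef, hEdef, mul_diagonal, diagonal_apply, Matrix.one_apply, ite_mul]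
  have hHE : H * E = E * H := by
    rw [hEH]
    ext1 (i | i) (j | j) <;>
      simp [hHdef, hEdef, diagonal_mul, diagonal_apply, Matrix.one_apply, mul_ite]
  have hxH : ‖(CStarMatrix.ofMatrix ((v - v₀) * H) :
      CStarMatrix (ι ⊕ κ) (ι ⊕ κ) (Unitization ℂ A))‖ < 1 / 4 := by
    refine hδ' _ fun i j => ?_
    have h1 : v i j - v₀ i j = ((v i j).snd : Unitization ℂ A) := by
      rw [hv₀, Matrix.map_apply, scalarEnd_apply, Unitization.algebraMap_eq_inl]
      exact sub_eq_of_eq_add' (Unitization.inl_fst_add_inr_snd_eq (v i j)).symm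
    have h2 : ((v - v₀) * H) i j =
        (((v i j).snd - (v i j).snd * g₀ : A) : Unitization ℂ A) := by
      rw [hHdef, mul_diagonal, Matrix.sub_apply, h1, hh₀, mul_sub, mul_one, Unitization.inr_sub,
        Unitization.inr_mul]
    rw [CStarMatrix.ofMatrix_apply, h2, Unitization.norm_inr]
    exact hsmall (i, j)
  have hnorm := norm_conj_sub_lt_one (D := CStarMatrix (ι ⊕ κ) (ι ⊕ κ) (Unitization ℂ A))
    (v := v₀) (x := v - v₀) hE hH hv₀1 hv₀2 hHv hHE hxH
  -- the projections `e ⊕ g` and `f ⊕ g` over the unitization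
  have hsplit : ∀ M : Matrix ι ι A, (fromBlocks M 0 0 g).map (unitizationInr A) =
      fromBlocks (M.map (unitizationInr A)) 0 0 (1 : Matrix κ κ (Unitization ℂ A)) - E * H := by
    intro M
    rw [hEH]
    ext1 (i | i) (j | j)
    · simp
    · simp
    · simp
    · by_cases hij : i = j
      · subst hij
        simp [hgdef, hh₀]
      · simp [hgdef, hij]
  have hP := isStarProjection_map (unitizationInr A) hp
  have hQ := isStarProjection_map (unitizationInr A) hq
  set P := (fromBlocks e 0 0 g).map (unitizationInr A) with hPdef
  set Q := (fromBlocks f 0 0 g).map (unitizationInr A) with hQdef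
  have hvP : star v * v * P = P := by
    have h1 : (fromBlocks (e.map (unitizationInr A)) 0 0 1 :
        Matrix (ι ⊕ κ) (ι ⊕ κ) (Unitization ℂ A)) * P = P := by
      have h2 : e.map (unitizationInr A) * e.map (unitizationInr A) = e.map (unitizationInr A) := by
        rw [← Matrix.map_mul, he.isIdempotentElem.eq]
      rw [hPdef, fromBlocks_map, Matrix.map_zero _ (map_zero _), Matrix.map_zero _ (map_zero _),
        fromBlocks_multiply, h2]
      simp
    rw [star_eq_conjTranspose, hv1, h1]
  have hvPv : v * P * star v - Q = -(v * (E * H) * star v - E * H) := by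
    have h1 : v * (star v * v) * star v = v * star v := by
      have h2 : (v * star v) * (v * star v) = v * star v := by
        have h3 : f.map (unitizationInr A) * f.map (unitizationInr A) =
            f.map (unitizationInr A) := by
          rw [← Matrix.map_mul, hf.isIdempotentElem.eq]
        rw [star_eq_conjTranspose, hv2, fromBlocks_multiply, h3]
        simp
      rw [← h2]
      simp only [mul_assoc]
    rw [hPdef, hQdef, hsplit, hsplit, ← hv1, ← hv2, ← star_eq_conjTranspose, mul_sub, sub_mul, h1]
    abel
  have hclose : ‖(CStarMatrix.ofMatrix (v * P * star v - Q) :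
      CStarMatrix (ι ⊕ κ) (ι ⊕ κ) (Unitization ℂ A))‖ < 1 := by
    have h1 : v₀ + (v - v₀) = v := by abel
    rw [hvPv]
    have h2 : ‖(CStarMatrix.ofMatrix (v * (E * H) * star v - E * H) :
      CStarMatrix (ι ⊕ κ) (ι ⊕ κ) (Unitization ℂ A))‖ < 1 := by
      conv in v => rw [← h1]
      conv in star v => rw [← h1]
      exact hnorm
    rw [← norm_neg] at h2
    exact h2
  obtain ⟨u, hu1, hu2⟩ := exists_mul_eq_of_norm_conj_sub_lt_one
    (D := CStarMatrix (ι ⊕ κ) (ι ⊕ κ) (Unitization ℂ A)) (v := v) (p := P) (q := Q)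
    hP hQ hvP hclose
  -- the partial isometry `u P` has entries in `A`
  obtain ⟨s, hs⟩ : ∃ s : Matrix (ι ⊕ κ) (ι ⊕ κ) A,
      s.map (unitizationInr A) = (CStarMatrix.ofMatrix.symm u) * P := by
    refine ⟨(CStarMatrix.ofMatrix.symm u * P).map fun x => x.snd, ?_⟩
    have h0 : (CStarMatrix.ofMatrix.symm u * P).map (scalarPart A) = 0 := by
      have h1 : P.map (scalarPart A) = 0 := by ext i j; simp [hPdef]
      rw [Matrix.map_mul, h1, Matrix.mul_zero]
    ext i j
    · have := congrFun (congrFun h0 i) j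
      simpa using this.symm
    · simp
  refine ⟨s, map_unitizationInr_injective ?_, map_unitizationInr_injective ?_⟩
  · change (sᴴ * s).map (unitizationInr A) = P
    rw [Matrix.map_mul, conjTranspose_map _ (map_star (unitizationInr A)), hs]
    exact hu1
  · change (s * sᴴ).map (unitizationInr A) = Q
    rw [Matrix.map_mul, conjTranspose_map _ (map_star (unitizationInr A)), hs]
    exact hu2

theorem V.mk_zero {R : Type*} [NonUnitalRing R] [StarRing R] {ι : Type*} [Fintype ι] :
    V.mk (0 : Matrix ι ι R) (.zero _) = 0 := by
  rw [V.zero_def, V.mk_eq_mk]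
  exact ⟨0, by simp, by simp⟩

theorem V.mk_eq_zero_iff {R : Type*} [NonUnitalRing R] [StarRing R] {ι : Type*} [Fintype ι]
    {p : Matrix ι ι R} {hp : IsStarProjection p} : V.mk p hp = 0 ↔ p = 0 := by
  constructor
  · intro h
    rw [V.zero_def, V.mk_eq_mk] at h
    obtain ⟨v, h1, -⟩ := h
    rw [← h1]
    ext i j
    simp [Matrix.mul_apply]
  · rintro rfl
    exact V.mk_zero

/-- Orthogonal projections add up in `V(R)`. -/
theorem V.mk_add_mk_of_mul_eq_zero {R : Type*} [NonUnitalRing R] [StarRing R] {ι : Type*}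
    [Fintype ι] {p q : Matrix ι ι R} (hp : IsStarProjection p) (hq : IsStarProjection q)
    (hpq : p * q = 0) (h : IsStarProjection (p + q)) :
    V.mk p hp + V.mk q hq = V.mk (p + q) h := by
  have h1 : pᴴ = p := hp.isSelfAdjoint
  have h2 : p * p = p := hp.isIdempotentElem
  have h3 : qᴴ = q := hq.isSelfAdjoint
  have h4 : q * q = q := hq.isIdempotentElem
  have hqp : q * p = 0 := by
    have := congrArg conjTranspose hpq
    rwa [conjTranspose_mul, h1, h3, conjTranspose_zero] at this
  rw [V.mk_add_mk, V.mk_eq_mk]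
  refine ⟨fromCols p q, ?_, ?_⟩
  · rw [conjTranspose_fromCols_eq_fromRows_conjTranspose, h1, h3]
    have h5 : fromBlocks p 0 0 q = fromBlocks (p * p) (p * q) (q * p) (q * q) := by
      rw [h2, h4, hpq, hqp]
    rw [h5]
    ext (i | i) (j | j) <;> rfl
  · rw [conjTranspose_fromCols_eq_fromRows_conjTranspose, h1, h3]
    nth_rewrite 3 [← h2]
    nth_rewrite 3 [← h4]
    ext i j
    simp [Matrix.mul_apply, Fintype.sum_sum_type]

/-- If `A` has real rank zero and `V(A)` is cancellative, then `V(A)` embeds in `K₀(A)`. -/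
theorem RealRankZero.ofV_injective (hRR : RealRankZero A) [IsCancelAdd (V A)] :
    Function.Injective (K0.ofV : V A → K0 A) := by
  intro x y hxy
  have h1 : Algebra.GrothendieckAddGroup.of (V.map (unitizationInr A) x) =
      Algebra.GrothendieckAddGroup.of (V.map (unitizationInr A) y) := congrArg Subtype.val hxy
  obtain ⟨⟨c, hctop⟩, hc⟩ := (AddLocalization.addMonoidOf ⊤).eq_iff_exists.1 h1
  change c + V.map (unitizationInr A) x = c + V.map (unitizationInr A) y at hc
  clear hxy h1 hctop
  induction x using V.ind with | _ n e he
  induction y using V.ind with | _ m f hf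
  induction c using V.ind with | _ k q hq
  have hpad1 : V.mk e he = V.mk (fromBlocks e 0 0 (0 : Matrix (Fin m) (Fin m) A))
      (isStarProjection_fromBlocks he (.zero _)) := by
    rw [← V.mk_add_mk he (.zero _), V.mk_zero, add_zero]
  have hpad2 : V.mk f hf = V.mk (fromBlocks (0 : Matrix (Fin n) (Fin n) A) 0 0 f)
      (isStarProjection_fromBlocks (.zero _) hf) := by
    rw [← V.mk_add_mk (.zero _) hf, V.mk_zero, zero_add]
  rw [hpad1, hpad2] at hc ⊢
  have hone : V.mk q hq + V.mk (1 - q) hq.one_sub =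
      V.mk (1 : Matrix (Fin k) (Fin k) (Unitization ℂ A)) (.one _) := by
    have h2 : q * q = q := hq.isIdempotentElem
    rw [V.mk_add_mk_of_mul_eq_zero hq hq.one_sub (by rw [mul_sub, mul_one, h2, sub_self])
      (by rw [add_sub_cancel]; exact .one _)]
    congr 1
    exact add_sub_cancel _ _
  have hc' := congrArg (V.mk (1 - q) hq.one_sub + ·) hc
  simp only [← add_assoc] at hc'
  rw [add_comm (V.mk (1 - q) hq.one_sub), hone, V.map_mk, V.map_mk, add_comm, V.mk_add_mk,
    add_comm, V.mk_add_mk, V.mk_eq_mk] at hc'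
  obtain ⟨g, hg, hg'⟩ := hRR.exists_mvN_fromBlocks (isStarProjection_fromBlocks he (.zero _))
    (isStarProjection_fromBlocks (.zero _) hf) hc'
  refine add_right_cancel (b := V.mk g hg) ?_
  rw [V.mk_add_mk, V.mk_add_mk, V.mk_eq_mk]
  exact hg'

end Injectivity

end KTheory

/-! ### The index map is well defined -/

namespace KTheory

open Matrix

section K0Unital

variable {A C : Type*} [Ring A] [StarRing A] [Ring C] [StarRing C] {ι κ : Type*} [Fintype ι]
  [Fintype κ]

theorem K0Unital.mk_eq_mk_of_mvN {p : Matrix ι ι A} {q : Matrix κ κ A} (hp : IsStarProjection p)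
    (hq : IsStarProjection q) (h : MvN p q) : K0Unital.mk p hp = K0Unital.mk q hq :=
  congrArg _ (V.mk_eq_mk.2 h)

theorem K0Unital.mk_fromBlocks {p : Matrix ι ι A} {q : Matrix κ κ A} (hp : IsStarProjection p)
    (hq : IsStarProjection q) :
    K0Unital.mk (fromBlocks p 0 0 q) (isStarProjection_fromBlocks hp hq) =
      K0Unital.mk p hp + K0Unital.mk q hq := by
  rw [K0Unital.mk, ← V.mk_add_mk hp hq, map_add]
  rfl

theorem K0Unital.map_mk (f : A →⋆ₙ+* C) {p : Matrix ι ι A} (hp : IsStarProjection p) :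
    K0Unital.map f (K0Unital.mk p hp) = K0Unital.mk (p.map f) (isStarProjection_map f hp) := by
  have h := Algebra.GrothendieckAddGroup.lift.symm_apply_apply
    (Algebra.GrothendieckAddGroup.of.comp (V.map f))
  rw [Algebra.GrothendieckAddGroup.lift_symm_apply] at h
  exact DFunLike.congr_fun h (V.mk p hp)

end K0Unital

theorem K0.incl_injective {A : Type*} [NonUnitalCStarAlgebra A] :
    Function.Injective (K0.incl : K0 A → K0Unital (Unitization ℂ A)) :=
  Subtype.val_injective

theorem K0.incl_ofV_mk {A : Type*} [NonUnitalCStarAlgebra A] {ι : Type*} [Fintype ι]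
    {p : Matrix ι ι A} (hp : IsStarProjection p) :
    K0.incl (K0.ofV (V.mk p hp)) =
      K0Unital.mk (p.map (unitizationInr A)) (isStarProjection_map _ hp) := rfl

section Pullback

variable {B : Type*} [CStarAlgebra B] (I : Ideal B) [I.IsTwoSided] [IsClosed (I : Set B)]

theorem unitizationToAlgebra_apply (x : Unitization ℂ (ClosedIdeal.toSubalgebra I)) :
    unitizationToAlgebra I x = algebraMap ℂ B x.fst + (x.snd : B) := rfl

variable {I} {ι κ : Type*}

/-- The maps `I⁺ → B` and `I⁺ → ℂ` are jointly injective. -/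
theorem matrix_ext_of_map {M M' : Matrix ι κ (Unitization ℂ (ClosedIdeal.toSubalgebra I))}
    (h1 : M.map (unitizationToAlgebra I) = M'.map (unitizationToAlgebra I))
    (h2 : M.map (scalarPart (ClosedIdeal.toSubalgebra I)) =
      M'.map (scalarPart (ClosedIdeal.toSubalgebra I))) : M = M' := by
  ext1 i j
  have h3 : (M i j).fst = (M' i j).fst := congrFun (congrFun h2 i) j
  have h4 : unitizationToAlgebra I (M i j) = unitizationToAlgebra I (M' i j) :=
    congrFun (congrFun h1 i) j
  rw [unitizationToAlgebra_apply, unitizationToAlgebra_apply, h3] at h4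
  exact Unitization.ext h3 (Subtype.ext (add_left_cancel h4))

/-- `I⁺` is the pullback of `B → B/I ← ℂ`: a matrix over `B` that is scalar modulo `I` comes from
a matrix over `I⁺`. -/
theorem exists_matrix_map_eq {b : Matrix ι κ B} {c : Matrix ι κ ℂ}
    (h : b.map (quotientHom I) = c.map (algebraMap ℂ (B ⧸ I))) :
    ∃ M : Matrix ι κ (Unitization ℂ (ClosedIdeal.toSubalgebra I)),
      M.map (unitizationToAlgebra I) = b ∧
      M.map (scalarPart (ClosedIdeal.toSubalgebra I)) = c := by
  have hmem : ∀ i j, b i j - algebraMap ℂ B (c i j) ∈ I := fun i j => by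
    rw [← quotientHom_eq_zero_iff, map_sub, AlgHomClass.commutes, sub_eq_zero]
    exact congrFun (congrFun h i) j
  refine ⟨Matrix.of fun i j => Unitization.inl (c i j) +
    ((⟨_, hmem i j⟩ : ClosedIdeal.toSubalgebra I) : Unitization ℂ _), ?_, ?_⟩
  · ext1 i j
    simp [unitizationToAlgebra_apply]
  · ext1 i j
    simp

theorem isStarProjection_of_map [Fintype ι]
    {P : Matrix ι ι (Unitization ℂ (ClosedIdeal.toSubalgebra I))}
    (h1 : IsStarProjection (P.map (unitizationToAlgebra I)))
    (h2 : IsStarProjection (P.map (scalarPart (ClosedIdeal.toSubalgebra I)))) :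
    IsStarProjection P := by
  refine ⟨matrix_ext_of_map ?_ ?_, matrix_ext_of_map ?_ ?_⟩
  · change (P * P).map _ = _
    rw [Matrix.map_mul, h1.isIdempotentElem.eq]
  · change (P * P).map _ = _
    rw [Matrix.map_mul, h2.isIdempotentElem.eq]
  · change Pᴴ.map _ = _
    rw [conjTranspose_map _ (map_star _)]
    exact h1.isSelfAdjoint
  · change Pᴴ.map _ = _
    rw [conjTranspose_map _ (map_star _)]
    exact h2.isSelfAdjoint

end Pullback

theorem map_basicProj {R S : Type*} [Ring R] [Ring S] {F : Type*} [FunLike F R S]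
    [RingHomClass F R S] (f : F) (n : ℕ) : (basicProj R n).map f = basicProj S n := by
  rw [basicProj, basicProj, fromBlocks_map, Matrix.map_one _ (map_zero f) (map_one f)]
  simp [Matrix.map_zero]

theorem map_scalarPart_basicProj (A : Type*) [NonUnitalCStarAlgebra A] (n : ℕ) :
    (basicProj (Unitization ℂ A) n).map (scalarPart A) = basicProj ℂ n :=
  map_basicProj (scalarPartHom A) n

theorem basicProj_conj_fromBlocks {R : Type*} [Ring R] [StarRing R] {n : ℕ}
    {a b : Matrix (Fin n) (Fin n) R} (ha : a * star a = 1) :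
    fromBlocks a 0 0 b * basicProj R n * star (fromBlocks a 0 0 b) = basicProj R n := by
  rw [star_fromBlocks, basicProj, fromBlocks_multiply, fromBlocks_multiply]
  simp [ha]

section Index

variable {B : Type*} [CStarAlgebra B] {I : Ideal B} [I.IsTwoSided] [IsClosed (I : Set B)]

/-- Two unitary lifts of `u ⊕ u*` differ by a unitary over `I⁺`, so they have the same index. -/
theorem IsIndex.unique {n : ℕ} {u : unitary (Matrix (Fin n) (Fin n) (B ⧸ I))}
    {k l : K0 (ClosedIdeal.toSubalgebra I)} (hk : IsIndex I u k) (hl : IsIndex I u l) :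
    k = l := by
  obtain ⟨⟨z, hzU⟩, hz, P, hP, hPB, hPC, hk⟩ := hk
  obtain ⟨⟨z', hzU'⟩, hz', P', hP', hPB', hPC', hl⟩ := hl
  dsimp only at hz hPB hz' hPB'
  refine K0.incl_injective ?_
  rw [hk, hl]
  congr 1
  have hzz : (z' * star z).map (quotientHom I) =
      (1 : Matrix (Fin n ⊕ Fin n) (Fin n ⊕ Fin n) ℂ).map (algebraMap ℂ (B ⧸ I)) := by
    have h1 : z * star z = 1 := Unitary.mul_star_self_of_mem hzU
    have h2 : (z * star z).map (quotientHom I) = 1 := by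
      rw [h1, Matrix.map_one _ (map_zero _) (map_one _)]
    rw [Matrix.map_one _ (map_zero _) (map_one _), ← h2, Matrix.map_mul, Matrix.map_mul]
    congr 1
    exact hz'.trans hz.symm
  obtain ⟨Y, hYB, hYC⟩ := exists_matrix_map_eq hzz
  have hzs : star z * z = 1 := Unitary.star_mul_self_of_mem hzU
  have hYs : (Yᴴ).map (unitizationToAlgebra I) =
      z * star z' := by
    rw [conjTranspose_map _ (map_star _), hYB, ← star_eq_conjTranspose, star_mul, star_star]
  have hYCs : (Yᴴ).map (scalarPart (ClosedIdeal.toSubalgebra I)) = 1 := by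
    rw [conjTranspose_map _ (map_star _), hYC, conjTranspose_one]
  have hYY : Yᴴ * Y = 1 := by
    refine matrix_ext_of_map ?_ ?_
    · have h1 : star z' * z' = 1 :=
        Unitary.star_mul_self_of_mem hzU'
      rw [Matrix.map_mul, hYs, hYB, Matrix.map_one _ (map_zero _) (map_one _)]
      calc _ = z * (star z' * z') *
            star z := by simp only [mul_assoc]
        _ = 1 := by rw [h1, mul_one]; exact Unitary.mul_star_self_of_mem hzU
    · rw [Matrix.map_mul, hYC, hYCs, Matrix.one_mul]
      exact (Matrix.map_one _ (map_zero (scalarPartHom _)) (map_one (scalarPartHom _))).symm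
  have hYP : Y * P * Yᴴ = P' := by
    refine matrix_ext_of_map ?_ ?_
    · rw [Matrix.map_mul, Matrix.map_mul, hYB, hYs, hPB, hPB']
      calc _ = z' * (star z * z) *
            basicProj B n * (star z * z) *
            star z' := by simp only [mul_assoc]
        _ = _ := by rw [hzs, mul_one, mul_one]
    · rw [Matrix.map_mul, Matrix.map_mul, hYC, hYCs, hPC, hPC', Matrix.one_mul, Matrix.mul_one]
  have hPs : Pᴴ = P := hP.isSelfAdjoint
  have hP2 : P * P = P := hP.isIdempotentElem
  refine K0Unital.mk_eq_mk_of_mvN hP hP' ⟨Y * P, ?_, ?_⟩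
  · rw [conjTranspose_mul, hPs, Matrix.mul_assoc, ← Matrix.mul_assoc Yᴴ, hYY, Matrix.one_mul, hP2]
  · rw [conjTranspose_mul, hPs, Matrix.mul_assoc, ← Matrix.mul_assoc P, hP2, ← Matrix.mul_assoc,
      hYP]

theorem exists_isIndex {n : ℕ} (u : unitary (Matrix (Fin n) (Fin n) (B ⧸ I))) :
    ∃ k, IsIndex I u k := by
  obtain ⟨z, hz, hzu⟩ := exists_unitary_matrix_map_eq_fromBlocks (quotientHom_surjective I) u.2
  have hlift : (z * basicProj B n * star z).map (quotientHom I) =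
      (basicProj ℂ n).map (algebraMap ℂ (B ⧸ I)) := by
    rw [map_basicProj, Matrix.map_mul, Matrix.map_mul, star_eq_conjTranspose,
      conjTranspose_map _ (map_star _), hzu, map_basicProj, ← star_eq_conjTranspose,
      basicProj_conj_fromBlocks (Unitary.coe_mul_star_self u)]
  obtain ⟨P, hPB, hPC⟩ := exists_matrix_map_eq hlift
  have hP : IsStarProjection P := by
    refine isStarProjection_of_map ?_ (hPC ▸ isStarProjection_basicProj ℂ n)
    rw [hPB]
    have h1 := isStarProjection_basicProj B n
    refine ⟨?_, ?_⟩
    · calc z * basicProj B n * star z * (z * basicProj B n * star z)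
          = z * basicProj B n * (star z * z) * basicProj B n * star z := by
            simp only [mul_assoc]
        _ = z * basicProj B n * star z := by
            rw [Unitary.star_mul_self_of_mem hz, mul_one, mul_assoc z,
              h1.isIdempotentElem.eq]
    · rw [isSelfAdjoint_iff, star_mul, star_mul, star_star, h1.isSelfAdjoint.star_eq, mul_assoc]
  have hker : K0Unital.mk P hP - K0Unital.mk (basicProj (Unitization ℂ _) n)
      (isStarProjection_basicProj _ n) ∈
      (K0Unital.map (scalarPart (ClosedIdeal.toSubalgebra I))).ker := by
    rw [AddMonoidHom.mem_ker, map_sub, K0Unital.map_mk, K0Unital.map_mk, sub_eq_zero]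
    congr 1
    rw [hPC, map_scalarPart_basicProj]
  exact ⟨⟨_, hker⟩, ⟨z, hz⟩, hzu, P, hP, hPB, hPC, rfl⟩

theorem IsIndex.of_joined {n : ℕ} {u v : unitary (Matrix (Fin n) (Fin n) (B ⧸ I))}
    (h : Joined u v) {k : K0 (ClosedIdeal.toSubalgebra I)} (hk : IsIndex I u k) :
    IsIndex I v k := by
  obtain ⟨⟨z, hzU⟩, hz, P, hP, hPB, hPC, hk⟩ := hk
  dsimp only at hz hPB
  obtain ⟨a, ha, hau⟩ := exists_unitary_matrix_map_eq_of_joined (quotientHom_surjective I) h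
  have h' : Joined (star u) (star v) := ⟨h.somePath.map continuous_star⟩
  obtain ⟨b, hb, hbu⟩ := exists_unitary_matrix_map_eq_of_joined (quotientHom_surjective I) h'
  rw [Unitary.coe_star, Unitary.coe_star, star_star] at hbu
  have hab : fromBlocks a 0 0 b ∈ unitary (Matrix (Fin n ⊕ Fin n) (Fin n ⊕ Fin n) B) := by
    rw [Unitary.mem_iff, star_fromBlocks, fromBlocks_multiply, fromBlocks_multiply,
      Unitary.star_mul_self_of_mem ha, Unitary.star_mul_self_of_mem hb,
      Unitary.mul_star_self_of_mem ha, Unitary.mul_star_self_of_mem hb]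
    simp
  have hu1 := Unitary.mul_star_self_of_mem u.2
  have hu2 := Unitary.star_mul_self_of_mem u.2
  have hzab : (z * fromBlocks a 0 0 b).map (quotientHom I) =
      fromBlocks (v : Matrix (Fin n) (Fin n) (B ⧸ I)) 0 0
        (star (v : Matrix (Fin n) (Fin n) (B ⧸ I))) := by
    rw [Matrix.map_mul, show z.map (quotientHom I) = _ from hz, fromBlocks_map, hau, hbu,
      Matrix.map_zero _ (map_zero _), fromBlocks_multiply,
      ← mul_assoc (u : Matrix (Fin n) (Fin n) (B ⧸ I)), hu1,
      ← mul_assoc (star (u : Matrix (Fin n) (Fin n) (B ⧸ I))), hu2]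
    simp
  have hconj : z * basicProj B n * star z =
      z * fromBlocks a 0 0 b * basicProj B n * star (z * fromBlocks a 0 0 b) := by
    rw [star_mul]
    calc _ = z * (fromBlocks a 0 0 b * basicProj B n * star (fromBlocks a 0 0 b)) * star z := by
          rw [basicProj_conj_fromBlocks (Unitary.mul_star_self_of_mem ha)]
      _ = _ := by simp only [mul_assoc]
  exact ⟨⟨_, mul_mem hzU hab⟩, hzab, P, hP, hPB.trans hconj, hPC, hk⟩

/-- The rearrangement of the summands of `(n ⊕ n) ⊕ (1 ⊕ 1)` as `(n + 1) ⊕ (n + 1)`. -/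
def stabilizeEquiv (n : ℕ) : (Fin n ⊕ Fin n) ⊕ (Fin 1 ⊕ Fin 1) ≃ Fin (n + 1) ⊕ Fin (n + 1) :=
  (Equiv.sumSumSumComm _ _ _ _).trans (Equiv.sumCongr finSumFinEquiv finSumFinEquiv)

theorem reindex_stabilizeEquiv_fromBlocks {R : Type*} [Zero R] {n : ℕ}
    (a b : Matrix (Fin n) (Fin n) R) (c d : Matrix (Fin 1) (Fin 1) R) :
    (fromBlocks (fromBlocks a 0 0 b) 0 0 (fromBlocks c 0 0 d)).reindex (stabilizeEquiv n)
      (stabilizeEquiv n) = fromBlocks ((fromBlocks a 0 0 c).reindex finSumFinEquiv finSumFinEquiv)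
        0 0 ((fromBlocks b 0 0 d).reindex finSumFinEquiv finSumFinEquiv) := by
  ext i j
  obtain ⟨i, rfl⟩ := (stabilizeEquiv n).surjective i
  obtain ⟨j, rfl⟩ := (stabilizeEquiv n).surjective j
  rw [reindex_apply, submatrix_apply, Equiv.symm_apply_apply, Equiv.symm_apply_apply]
  rcases i with (i | i) | (i | i) <;> rcases j with (j | j) | (j | j) <;>
    simp [stabilizeEquiv]

theorem reindex_basicProj {R : Type*} [Ring R] (n : ℕ) :
    (fromBlocks (basicProj R n) 0 0 (basicProj R 1)).reindex (stabilizeEquiv n)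
      (stabilizeEquiv n) = basicProj R (n + 1) := by
  rw [basicProj, basicProj, reindex_stabilizeEquiv_fromBlocks, basicProj, fromBlocks_one]
  simp

theorem IsIndex.stabilize {n : ℕ} {u : unitary (Matrix (Fin n) (Fin n) (B ⧸ I))}
    {v : unitary (Matrix (Fin (n + 1)) (Fin (n + 1)) (B ⧸ I))}
    (h : (v : Matrix (Fin (n + 1)) (Fin (n + 1)) (B ⧸ I)) =
      (fromBlocks (u : Matrix (Fin n) (Fin n) (B ⧸ I)) 0 0 1).reindex
        finSumFinEquiv finSumFinEquiv)
    {k : K0 (ClosedIdeal.toSubalgebra I)} (hk : IsIndex I u k) : IsIndex I v k := by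
  obtain ⟨⟨z, hzU⟩, hz, P, hP, hPB, hPC, hk⟩ := hk
  dsimp only at hz hPB
  have hmul : ∀ M M' : Matrix ((Fin n ⊕ Fin n) ⊕ (Fin 1 ⊕ Fin 1)) _ B,
      M.reindex (stabilizeEquiv n) (stabilizeEquiv n) *
        M'.reindex (stabilizeEquiv n) (stabilizeEquiv n) =
      (M * M').reindex (stabilizeEquiv n) (stabilizeEquiv n) := fun M M' =>
    submatrix_mul_equiv M M' _ _ _
  have hstar : ∀ M : Matrix ((Fin n ⊕ Fin n) ⊕ (Fin 1 ⊕ Fin 1)) _ B,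
      star (M.reindex (stabilizeEquiv n) (stabilizeEquiv n)) =
      Mᴴ.reindex (stabilizeEquiv n) (stabilizeEquiv n) := fun M => rfl
  have hone : (1 : Matrix ((Fin n ⊕ Fin n) ⊕ (Fin 1 ⊕ Fin 1)) _ B).reindex (stabilizeEquiv n)
      (stabilizeEquiv n) = 1 := submatrix_one_equiv _
  have hz1 : zᴴ * z = 1 := Unitary.star_mul_self_of_mem hzU
  have hz2 : z * zᴴ = 1 := Unitary.mul_star_self_of_mem hzU
  have hz' : (fromBlocks z 0 0
      (1 : Matrix (Fin 1 ⊕ Fin 1) (Fin 1 ⊕ Fin 1) B)).reindex (stabilizeEquiv n)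
        (stabilizeEquiv n) ∈ unitary (Matrix (Fin (n + 1) ⊕ Fin (n + 1)) _ B) := by
    rw [Unitary.mem_iff, hstar, hmul, hmul, fromBlocks_conjTranspose, fromBlocks_multiply,
      fromBlocks_multiply]
    simp only [conjTranspose_zero, conjTranspose_one, Matrix.mul_zero, Matrix.zero_mul, add_zero,
      zero_add, Matrix.mul_one, hz1, hz2, fromBlocks_one, hone, and_self]
  have hP' := isStarProjection_fromBlocks hP
    (isStarProjection_basicProj (Unitization ℂ (ClosedIdeal.toSubalgebra I)) 1)
  refine ⟨⟨_, hz'⟩, ?_, (fromBlocks P 0 0 (basicProj _ 1)).reindex (stabilizeEquiv n)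
    (stabilizeEquiv n), isStarProjection_reindex hP' _, ?_, ?_, ?_⟩
  · change ((fromBlocks z 0 0 1).map (quotientHom I)).reindex
      (stabilizeEquiv n) (stabilizeEquiv n) = _
    rw [fromBlocks_map, show z.map (quotientHom I) = _ from hz,
      Matrix.map_one _ (map_zero _) (map_one _), Matrix.map_zero _ (map_zero _),
      Matrix.map_zero _ (map_zero _), ← fromBlocks_one, reindex_stabilizeEquiv_fromBlocks, h]
    congr 1
    change _ = (fromBlocks (u : Matrix (Fin n) (Fin n) (B ⧸ I)) 0 0 1)ᴴ.reindex _ _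
    rw [fromBlocks_conjTranspose]
    simp [star_eq_conjTranspose]
  · change ((fromBlocks P 0 0 (basicProj _ 1)).map (unitizationToAlgebra I)).reindex
      (stabilizeEquiv n) (stabilizeEquiv n) =
        (fromBlocks z 0 0 1).reindex (stabilizeEquiv n) (stabilizeEquiv n) *
        basicProj B (n + 1) *
        star ((fromBlocks z 0 0 1).reindex (stabilizeEquiv n) (stabilizeEquiv n))
    rw [fromBlocks_map, hPB, map_basicProj, ← reindex_basicProj n, hstar, hmul, hmul,
      fromBlocks_conjTranspose, fromBlocks_multiply, fromBlocks_multiply]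
    simp [Matrix.map_zero, star_eq_conjTranspose]
  · change ((fromBlocks P 0 0 (basicProj _ 1)).map (scalarPart _)).reindex
      (stabilizeEquiv n) (stabilizeEquiv n) = _
    rw [fromBlocks_map, hPC, map_scalarPart_basicProj, ← reindex_basicProj n,
      Matrix.map_zero _ (map_zero _), Matrix.map_zero _ (map_zero _)]
  · have h1 := K0Unital.mk_eq_mk_of_mvN hP' (isStarProjection_reindex hP' _)
      (MvN.reindex hP' (stabilizeEquiv n))
    have hp := isStarProjection_fromBlocks
      (isStarProjection_basicProj (Unitization ℂ (ClosedIdeal.toSubalgebra I)) n)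
      (isStarProjection_basicProj (Unitization ℂ (ClosedIdeal.toSubalgebra I)) 1)
    have h2 := K0Unital.mk_eq_mk_of_mvN hp (isStarProjection_basicProj _ (n + 1))
      (by
        rw [← reindex_basicProj n]
        exact MvN.reindex hp (stabilizeEquiv n))
    rw [← h1, ← h2, K0Unital.mk_fromBlocks hP (isStarProjection_basicProj _ 1),
      K0Unital.mk_fromBlocks (isStarProjection_basicProj _ n) (isStarProjection_basicProj _ 1),
      add_sub_add_right_eq_sub, hk]

/-- The index depends only on the class in `K₁(B/I)`. -/
theorem IsIndex.unique_of_mk_eq {n m : ℕ} {u : unitary (Matrix (Fin n) (Fin n) (B ⧸ I))}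
    {v : unitary (Matrix (Fin m) (Fin m) (B ⧸ I))} (h : K1.mk u = K1.mk v)
    {k l : K0 (ClosedIdeal.toSubalgebra I)} (hk : IsIndex I u k) (hl : IsIndex I v l) :
    k = l := by
  let F : K1 (B ⧸ I) → K0 (ClosedIdeal.toSubalgebra I) :=
    Quot.lift (fun x : MatUnitary (B ⧸ I) => (exists_isIndex x.2).choose) fun x y hxy => by
      have hx := (exists_isIndex x.2).choose_spec
      have hy := (exists_isIndex y.2).choose_spec
      cases hxy with
      | homotopy u v h => exact (hx.of_joined h).unique hy
      | stabilize u v h => exact (hx.stabilize h).unique hy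
  have h1 : F (K1.mk u) = k := (exists_isIndex u).choose_spec.unique hk
  have h2 : F (K1.mk v) = l := (exists_isIndex v).choose_spec.unique hl
  rw [← h1, ← h2, h]

theorem IsIndex.indexMap_eq {n : ℕ} {u : unitary (Matrix (Fin n) (Fin n) (B ⧸ I))}
    {k : K0 (ClosedIdeal.toSubalgebra I)} (hk : IsIndex I u k) : indexMap I (K1.mk u) = k := by
  have h : ∃ k : K0 (ClosedIdeal.toSubalgebra I),
      ∃ (m : ℕ) (v : unitary (Matrix (Fin m) (Fin m) (B ⧸ I))), K1.mk v = K1.mk u ∧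
        IsIndex I v k := ⟨k, n, u, rfl, hk⟩
  rw [indexMap, dif_pos h]
  obtain ⟨m, v, hv, hl⟩ := h.choose_spec
  exact hl.unique_of_mk_eq hv hk

end Index

end KTheory

/-! ### The index of a unitary with a partially isometric lift -/

namespace KTheory

open Matrix

section DiagOne

/-- An element of a ring as a `1 × 1` matrix. -/
def diagOne {R : Type*} [Zero R] (x : R) : Matrix (Fin 1) (Fin 1) R := diagonal fun _ => x

theorem diagOne_zero {R : Type*} [Zero R] : diagOne (0 : R) = 0 := diagonal_zero

theorem diagOne_one {R : Type*} [Ring R] : diagOne (1 : R) = 1 := diagonal_one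

theorem diagOne_add {R : Type*} [NonUnitalRing R] (x y : R) :
    diagOne x + diagOne y = diagOne (x + y) := diagonal_add _ _

theorem diagOne_mul {R : Type*} [NonUnitalRing R] (x y : R) :
    diagOne x * diagOne y = diagOne (x * y) := diagonal_mul_diagonal _ _

theorem star_diagOne {R : Type*} [NonUnitalRing R] [StarRing R] (x : R) :
    star (diagOne x) = diagOne (star x) := diagonal_conjTranspose _

theorem map_diagOne {R S : Type*} [Zero R] [Zero S] (f : R → S) (hf : f 0 = 0) (x : R) :
    (diagOne x).map f = diagOne (f x) := diagonal_map hf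

theorem diagOne_injective {R : Type*} [Zero R] : Function.Injective (diagOne : R → _) :=
  fun _ _ h => congrFun (diagonal_injective h) 0

variable {R : Type*} [NonUnitalRing R] [StarRing R]

theorem isStarProjection_diagOne {x : R} (hx : IsStarProjection x) :
    IsStarProjection (diagOne x) :=
  ⟨by rw [IsIdempotentElem, diagOne_mul, hx.isIdempotentElem.eq],
    by rw [isSelfAdjoint_iff, star_diagOne, hx.isSelfAdjoint.star_eq]⟩

/-- The class in `V(R)` of a projection of `R`. -/
noncomputable def V.ofProj (x : R) (hx : IsStarProjection x) : V R :=
  V.mk (diagOne x) (isStarProjection_diagOne hx)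

theorem V.ofProj_eq_zero_iff {x : R} {hx : IsStarProjection x} : V.ofProj x hx = 0 ↔ x = 0 := by
  rw [V.ofProj, V.mk_eq_zero_iff, ← diagOne_zero, diagOne_injective.eq_iff]

/-- If `[e] ≤ [f]` in `V(R)`, then some partial isometry with initial projection `e` has range
in `f`. -/
theorem V.exists_star_mul_self_eq_of_add_eq {e f : R} {he : IsStarProjection e}
    {hf : IsStarProjection f} {a : V R} (h : V.ofProj e he + a = V.ofProj f hf) :
    ∃ t : R, star t * t = e ∧ f * t = t ∧ t * e = t := by
  induction a using V.ind with | _ n p hp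
  have hq := isStarProjection_fromBlocks (isStarProjection_diagOne he) hp
  rw [V.ofProj, V.ofProj, V.mk_add_mk, V.mk_eq_mk] at h
  obtain ⟨s, hs1, hs2⟩ := h
  set q := fromBlocks (diagOne e) 0 0 p with hqdef
  have hqs : qᴴ = q := hq.isSelfAdjoint
  have hq2 : q * q = q := hq.isIdempotentElem
  -- multiplying by `q` makes `s` a genuine partial isometry without using a C*-norm
  have h1 : (s * q)ᴴ * (s * q) = q := by
    rw [conjTranspose_mul, hqs, Matrix.mul_assoc, ← Matrix.mul_assoc sᴴ, hs1, hq2, hq2]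
  have h2 : diagOne f * (s * q) = s * q := by
    rw [← hs2, Matrix.mul_assoc, ← Matrix.mul_assoc sᴴ, hs1, hq2]
  have h3 : s * q * q = s * q := by rw [Matrix.mul_assoc, hq2]
  refine ⟨(s * q) 0 (Sum.inl 0), ?_, ?_, ?_⟩
  · have := congrFun (congrFun h1 (Sum.inl 0)) (Sum.inl 0)
    rw [Matrix.mul_apply, Fin.sum_univ_one, conjTranspose_apply] at this
    rw [this, hqdef, fromBlocks_apply₁₁, diagOne, diagonal_apply_eq]
  · have := congrFun (congrFun h2 0) (Sum.inl 0)
    rwa [diagOne, diagonal_mul] at this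
  · have := congrFun (congrFun h3 0) (Sum.inl 0)
    rw [Matrix.mul_apply, Fintype.sum_sum_type, Fin.sum_univ_one] at this
    simpa [hqdef, diagOne] using this

end DiagOne

section PartialIsometry

variable {B : Type*} [CStarAlgebra B] {I : Ideal B} [I.IsTwoSided] [IsClosed (I : Set B)]

theorem mul_eq_zero_of_star_mul_self_eq_one_sub {v e : B} (he : IsStarProjection e)
    (h : star v * v = 1 - e) : v * e = 0 := by
  rw [← CStarRing.star_mul_self_eq_zero_iff, star_mul, he.isSelfAdjoint.star_eq, mul_assoc,
    ← mul_assoc (star v), h, sub_mul, one_mul, he.isIdempotentElem.eq, sub_self, mul_zero]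

theorem isStarProjection_coe {e : ClosedIdeal.toSubalgebra I} (he : IsStarProjection e) :
    IsStarProjection (e : B) :=
  ⟨congrArg Subtype.val he.isIdempotentElem.eq, congrArg Subtype.val he.isSelfAdjoint.star_eq⟩

/-- If `v` is a partial isometry that lifts `w`, then the matrix with rows `(v, 1 - vv*)` and
`(1 - v*v, v*)` is a unitary lift of `w ⊕ w*`, so that `δ[w] = [1 - v*v] - [1 - vv*]`. -/
theorem isIndex_of_partialIsometry {v : B} {e f : ClosedIdeal.toSubalgebra I}
    (he : IsStarProjection e) (hf : IsStarProjection f) (hve : star v * v = 1 - (e : B))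
    (hvf : v * star v = 1 - (f : B)) {w : unitary (B ⧸ I)} (hvw : quotientHom I v = w) :
    IsIndex I (matOne w) (K0.ofV (V.ofProj e he) - K0.ofV (V.ofProj f hf)) := by
  have heB := isStarProjection_coe he
  have hfB := isStarProjection_coe hf
  have hes : star (e : B) = e := heB.isSelfAdjoint
  have hfs : star (f : B) = f := hfB.isSelfAdjoint
  have he2 : (e : B) * e = e := heB.isIdempotentElem
  have hf2 : (f : B) * f = f := hfB.isIdempotentElem
  have hve0 : v * e = 0 := mul_eq_zero_of_star_mul_self_eq_one_sub heB hve
  have hvf0 : star v * f = 0 :=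
    mul_eq_zero_of_star_mul_self_eq_one_sub hfB (by rw [star_star, hvf])
  have hev0 : (e : B) * star v = 0 := by
    have := congrArg star hve0
    rwa [star_mul, hes, star_zero] at this
  have hfv0 : (f : B) * v = 0 := by
    have := congrArg star hvf0
    rwa [star_mul, hfs, star_star, star_zero] at this
  set z : Matrix (Fin 1 ⊕ Fin 1) (Fin 1 ⊕ Fin 1) B :=
    fromBlocks (diagOne v) (diagOne (f : B)) (diagOne (e : B)) (diagOne (star v)) with hz
  have hzs : star z = fromBlocks (diagOne (star v)) (diagOne (e : B)) (diagOne (f : B))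
      (diagOne v) := by
    rw [hz, star_fromBlocks, star_diagOne, star_diagOne, star_diagOne, star_diagOne, star_star,
      hes, hfs]
  have hzU : z ∈ unitary (Matrix (Fin 1 ⊕ Fin 1) (Fin 1 ⊕ Fin 1) B) := by
    rw [Unitary.mem_iff, hzs, hz, fromBlocks_multiply, fromBlocks_multiply]
    simp only [diagOne_mul, diagOne_add, hve, hvf, he2, hf2, hve0, hvf0, hev0, hfv0,
      sub_add_cancel, add_sub_cancel, add_zero, diagOne_zero, diagOne_one, fromBlocks_one,
      and_self]
  have hone : IsStarProjection ((1 : Unitization ℂ (ClosedIdeal.toSubalgebra I)) -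
      (f : Unitization ℂ (ClosedIdeal.toSubalgebra I))) :=
    IsStarProjection.one_sub (hf.map (unitizationInr (ClosedIdeal.toSubalgebra I)))
  have heU : IsStarProjection (e : Unitization ℂ (ClosedIdeal.toSubalgebra I)) :=
    he.map (unitizationInr (ClosedIdeal.toSubalgebra I))
  have hfU : IsStarProjection (f : Unitization ℂ (ClosedIdeal.toSubalgebra I)) :=
    hf.map (unitizationInr (ClosedIdeal.toSubalgebra I))
  have hP := isStarProjection_fromBlocks (isStarProjection_diagOne hone)
    (isStarProjection_diagOne heU)
  have hinr : ∀ x : ClosedIdeal.toSubalgebra I, unitizationToAlgebra I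
      (x : Unitization ℂ (ClosedIdeal.toSubalgebra I)) = (x : B) := fun x => by
    rw [unitizationToAlgebra_apply, Unitization.fst_inr, map_zero, zero_add, Unitization.snd_inr]
  refine ⟨⟨z, hzU⟩, ?_, _, hP, ?_, ?_, ?_⟩
  · change z.map (quotientHom I) = fromBlocks (diagOne (w : B ⧸ I)) 0 0
      (star (diagOne (w : B ⧸ I)))
    rw [hz, fromBlocks_map, map_diagOne _ (map_zero _), map_diagOne _ (map_zero _),
      map_diagOne _ (map_zero _), map_diagOne _ (map_zero _), quotientHom_coe, quotientHom_coe,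
      map_star, hvw, star_diagOne, diagOne_zero]
  · change _ = z * basicProj B 1 * star z
    rw [hzs, hz, basicProj, fromBlocks_multiply, fromBlocks_multiply, fromBlocks_map,
      map_diagOne _ (map_zero _), map_diagOne _ (map_zero _), map_sub, map_one, hinr, hinr,
      Matrix.map_zero _ (map_zero _)]
    simp only [Matrix.mul_one, Matrix.mul_zero, Matrix.zero_mul, add_zero, diagOne_mul, hvf, hve0,
      hev0, he2, diagOne_zero]
  · rw [basicProj, fromBlocks_map, map_diagOne _ (map_zero _), map_diagOne _ (map_zero _),
      Matrix.map_zero _ (map_zero _)]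
    have h1 : scalarPart (ClosedIdeal.toSubalgebra I)
        (1 - (f : Unitization ℂ (ClosedIdeal.toSubalgebra I))) = 1 := by
      rw [map_sub, scalarPart_apply, scalarPart_apply, Unitization.fst_one, Unitization.fst_inr,
        sub_zero]
    rw [h1, scalarPart_apply, Unitization.fst_inr, diagOne_zero, diagOne_one]
  · have hmap : ∀ (x : ClosedIdeal.toSubalgebra I) (hx : IsStarProjection x)
        (hxU : IsStarProjection (x : Unitization ℂ (ClosedIdeal.toSubalgebra I))),
        K0.incl (K0.ofV (V.ofProj x hx)) =
          K0Unital.mk (diagOne (x : Unitization ℂ (ClosedIdeal.toSubalgebra I)))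
            (isStarProjection_diagOne hxU) := fun x hx hxU => by
      rw [V.ofProj, K0.incl_ofV_mk]
      congr 1
      exact map_diagOne _ (map_zero (unitizationInr _)) x
    -- `[1] = [1 - f] + [f]` over the unitization
    have hsum : K0Unital.mk (basicProj (Unitization ℂ (ClosedIdeal.toSubalgebra I)) 1)
        (isStarProjection_basicProj _ 1) =
        K0Unital.mk _ (isStarProjection_diagOne hone) +
          K0Unital.mk _ (isStarProjection_diagOne hfU) := by
      have h1 : diagOne (1 - (f : Unitization ℂ (ClosedIdeal.toSubalgebra I))) +
          diagOne (f : Unitization ℂ (ClosedIdeal.toSubalgebra I)) = 1 := by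
        rw [diagOne_add, sub_add_cancel, diagOne_one]
      have h2 : K0Unital.mk (basicProj (Unitization ℂ (ClosedIdeal.toSubalgebra I)) 1)
          (isStarProjection_basicProj _ 1) =
          K0Unital.mk (1 : Matrix (Fin 1) (Fin 1) _) (.one _) := by
        refine (K0Unital.mk_fromBlocks (.one _) (.zero _)).trans ?_
        rw [K0Unital.mk, K0Unital.mk, V.mk_zero, map_zero, add_zero]
      rw [h2, K0Unital.mk, K0Unital.mk, K0Unital.mk, ← map_add,
        V.mk_add_mk_of_mul_eq_zero (isStarProjection_diagOne hone) (isStarProjection_diagOne hfU)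
          (by rw [diagOne_mul, sub_mul, one_mul, hfU.isIdempotentElem.eq, sub_self, diagOne_zero])
          (by rw [h1]; exact .one _)]
      congr 2
      exact h1.symm
    rw [map_sub, hmap e he heU, hmap f hf hfU,
      K0Unital.mk_fromBlocks (isStarProjection_diagOne hone) (isStarProjection_diagOne heU), hsum]
    abel

theorem mem_of_quotientHom_eq_one {x : B} (h : quotientHom I x = 1) : 1 - x ∈ I := by
  rw [← quotientHom_eq_zero_iff, map_sub, map_one, h, sub_self]

/-- The defect projections of a partially isometric lift of a unitary lie in the ideal. -/
theorem exists_defect_projections {v : B} (hv : IsStarProjection (star v * v))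
    {w : unitary (B ⧸ I)} (hvw : quotientHom I v = w) :
    ∃ e f : ClosedIdeal.toSubalgebra I, IsStarProjection e ∧ IsStarProjection f ∧
      star v * v = 1 - (e : B) ∧ v * star v = 1 - (f : B) := by
  have h1 : 1 - star v * v ∈ I := mem_of_quotientHom_eq_one (by
    rw [map_mul, map_star, hvw, Unitary.coe_star_mul_self])
  have h2 : 1 - v * star v ∈ I := mem_of_quotientHom_eq_one (by
    rw [map_mul, map_star, hvw, Unitary.mul_star_self_of_mem w.2])
  have hv' := isStarProjection_mul_star_self hv
  exact ⟨⟨_, h1⟩, ⟨_, h2⟩,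
    ⟨Subtype.ext hv.one_sub.isIdempotentElem, Subtype.ext hv.one_sub.isSelfAdjoint⟩,
    ⟨Subtype.ext hv'.one_sub.isIdempotentElem, Subtype.ext hv'.one_sub.isSelfAdjoint⟩,
    (sub_sub_cancel _ _).symm, (sub_sub_cancel _ _).symm⟩

/-- The index of a unitary that lifts to an isometry `z` is `-[1 - zz*]`. -/
theorem exists_indexMap_eq_neg_of_isometry {z : B} (hz : star z * z = 1) {w : unitary (B ⧸ I)}
    (hzw : quotientHom I z = w) :
    ∃ (f : ClosedIdeal.toSubalgebra I) (hf : IsStarProjection f), z * star z = 1 - (f : B) ∧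
      indexMap I (K1.ofUnitary w) = -K0.ofV (V.ofProj f hf) := by
  obtain ⟨e, f, he, hf, hze, hzf⟩ := exists_defect_projections (by rw [hz]; exact .one B) hzw
  have he0 : e = 0 := Subtype.ext (by
    rw [hz] at hze
    exact (sub_eq_self.1 hze.symm))
  refine ⟨f, hf, hzf, ?_⟩
  have := (isIndex_of_partialIsometry he hf hze hzf hzw).indexMap_eq
  rwa [V.ofProj_eq_zero_iff.2 he0, map_zero, zero_sub] at this

/-- The index of a unitary that lifts to a co-isometry `z` is `[1 - z*z]`. -/
theorem exists_indexMap_eq_of_coisometry {z : B} (hz : z * star z = 1) {w : unitary (B ⧸ I)}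
    (hzw : quotientHom I z = w) :
    ∃ (e : ClosedIdeal.toSubalgebra I) (he : IsStarProjection e), star z * z = 1 - (e : B) ∧
      indexMap I (K1.ofUnitary w) = K0.ofV (V.ofProj e he) := by
  have hz' : IsStarProjection (star z * z) := by
    have := isStarProjection_mul_star_self (v := star z) (by rw [star_star, hz]; exact .one B)
    rwa [star_star] at this
  obtain ⟨e, f, he, hf, hze, hzf⟩ := exists_defect_projections hz' hzw
  have hf0 : f = 0 := Subtype.ext (by
    rw [hz] at hzf
    exact (sub_eq_self.1 hzf.symm))
  refine ⟨e, he, hze, ?_⟩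
  have := (isIndex_of_partialIsometry he hf hze hzf hzw).indexMap_eq
  rwa [V.ofProj_eq_zero_iff.2 hf0, map_zero, sub_zero] at this

/-- A partially isometric lift `v` of `w` with `[1 - v*v] ≤ [1 - vv*]` extends to an isometry
`v + t` that lifts `w`. -/
theorem exists_isometry_of_add_eq {v : B} {e f : ClosedIdeal.toSubalgebra I}
    {he : IsStarProjection e} {hf : IsStarProjection f} (hve : star v * v = 1 - (e : B))
    (hvf : v * star v = 1 - (f : B)) {a : V (ClosedIdeal.toSubalgebra I)}
    (h : V.ofProj e he + a = V.ofProj f hf) :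
    ∃ z : B, star z * z = 1 ∧ quotientHom I z = quotientHom I v := by
  obtain ⟨t, ht1, ht2, -⟩ := V.exists_star_mul_self_eq_of_add_eq h
  have ht1' : star (t : B) * t = e := congrArg Subtype.val ht1
  have ht2' : (f : B) * t = t := congrArg Subtype.val ht2
  have hvf0 : star v * f = 0 := mul_eq_zero_of_star_mul_self_eq_one_sub
    (isStarProjection_coe hf) (by rw [star_star, hvf])
  have hvt : star v * t = 0 := by rw [← ht2', ← mul_assoc, hvf0, zero_mul]
  have htv : star (t : B) * v = 0 := by
    have := congrArg star hvt
    rwa [star_mul, star_star, star_zero] at this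
  refine ⟨v + t, ?_, by rw [map_add, quotientHom_coe, add_zero]⟩
  rw [star_add, add_mul, mul_add, mul_add, hve, hvt, htv, ht1', add_zero, zero_add,
    sub_add_cancel]

end PartialIsometry

end KTheory

/-! ### Lifting unitaries modulo an ideal of real rank zero -/

namespace KTheory

variable {B : Type*} [CStarAlgebra B] {I : Ideal B} [I.IsTwoSided] [IsClosed (I : Set B)]

/-- A unitary whose index is at most zero lifts to an isometry. -/
theorem RealRankZero.exists_isometry_of_indexMap_add_eq_zero
    (hRR : RealRankZero (ClosedIdeal.toSubalgebra I)) [IsCancelAdd (V (ClosedIdeal.toSubalgebra I))]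
    {w : unitary (B ⧸ I)} {a : V (ClosedIdeal.toSubalgebra I)}
    (h : indexMap I (K1.ofUnitary w) + K0.ofV a = 0) :
    ∃ z : B, star z * z = 1 ∧ quotientHom I z = w := by
  obtain ⟨v, hv, hvw⟩ := hRR.exists_partialIsometry_lift I w
  obtain ⟨e, f, he, hf, hve, hvf⟩ := exists_defect_projections hv hvw
  have hidx := (isIndex_of_partialIsometry he hf hve hvf hvw).indexMap_eq
  have hδ : indexMap I (K1.ofUnitary w) = K0.ofV (V.ofProj e he) - K0.ofV (V.ofProj f hf) := hidx
  have hadd : V.ofProj e he + a = V.ofProj f hf := hRR.ofV_injective (by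
    rw [map_add, ← sub_eq_zero, ← h, hδ]
    abel)
  obtain ⟨z, hz, hzv⟩ := exists_isometry_of_add_eq hve hvf hadd
  exact ⟨z, hz, hzv.trans hvw⟩

/-- A unitary whose index is at least zero lifts to a co-isometry: the adjoint of an isometric lift
of the adjoint. -/
theorem RealRankZero.exists_coisometry_of_indexMap_eq
    (hRR : RealRankZero (ClosedIdeal.toSubalgebra I)) [IsCancelAdd (V (ClosedIdeal.toSubalgebra I))]
    {w : unitary (B ⧸ I)} {a : V (ClosedIdeal.toSubalgebra I)}
    (h : indexMap I (K1.ofUnitary w) = K0.ofV a) :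
    ∃ z : B, z * star z = 1 ∧ quotientHom I z = w := by
  obtain ⟨v, hv, hvw⟩ := hRR.exists_partialIsometry_lift I w
  obtain ⟨e, f, he, hf, hve, hvf⟩ := exists_defect_projections hv hvw
  have hidx := (isIndex_of_partialIsometry he hf hve hvf hvw).indexMap_eq
  have hδ : indexMap I (K1.ofUnitary w) = K0.ofV (V.ofProj e he) - K0.ofV (V.ofProj f hf) := hidx
  have hadd : V.ofProj f hf + a = V.ofProj e he := hRR.ofV_injective (by
    rw [map_add, ← h, hδ]
    abel)
  obtain ⟨z, hz, hzv⟩ := exists_isometry_of_add_eq (v := star v) (by rwa [star_star])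
    (by rwa [star_star]) hadd
  refine ⟨star z, by rwa [star_star], ?_⟩
  rw [map_star, hzv, map_star, star_star, hvw]

theorem indexMap_eq_zero_of_mem_unitary {z : B} (hz : z ∈ unitary B) {w : unitary (B ⧸ I)}
    (hzw : quotientHom I z = w) : indexMap I (K1.ofUnitary w) = 0 := by
  obtain ⟨hz1, hz2⟩ := Unitary.mem_iff.1 hz
  obtain ⟨f, hf, hzf, hidx⟩ := exists_indexMap_eq_neg_of_isometry hz1 hzw
  have hf0 : f = 0 := Subtype.ext (sub_eq_self.1 (hzf.symm.trans hz2))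
  rw [hidx, V.ofProj_eq_zero_iff.2 hf0, map_zero, neg_zero]

end KTheory

theorem proposition2p2 {B : Type*} [CStarAlgebra B]
    (I : Ideal B) [I.IsTwoSided] [IsClosed (I : Set B)]
    (hRR : KTheory.RealRankZero (ClosedIdeal.toSubalgebra I))
    (hV : IsCancelAdd (KTheory.V (ClosedIdeal.toSubalgebra I)))
    (w : unitary (B ⧸ I)) :
    ((∃ z ∈ unitary B, Ideal.Quotient.mk I z = (w : B ⧸ I)) ↔
      KTheory.indexMap I (KTheory.K1.ofUnitary w) = 0) ∧
    ((∃ z : B, KTheory.IsProperIsometry z ∧ Ideal.Quotient.mk I z = (w : B ⧸ I)) ↔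
      KTheory.indexMap I (KTheory.K1.ofUnitary w) < 0) ∧
    ((∃ z : B, KTheory.IsProperCoisometry z ∧ Ideal.Quotient.mk I z = (w : B ⧸ I)) ↔
      0 < KTheory.indexMap I (KTheory.K1.ofUnitary w)) := by
  refine ⟨⟨?_, fun h => ?_⟩, ⟨?_, ?_⟩, ⟨?_, ?_⟩⟩
  · rintro ⟨z, hz, hzw⟩
    exact KTheory.indexMap_eq_zero_of_mem_unitary hz hzw
  · obtain ⟨z, hz, hzw⟩ := hRR.exists_isometry_of_indexMap_add_eq_zero (a := 0)
      (by rw [h, map_zero, add_zero])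
    obtain ⟨f, hf, hzf, hidx⟩ := KTheory.exists_indexMap_eq_neg_of_isometry hz hzw
    -- the defect projection of the isometric lift has class zero, so the lift is unitary
    have hf0 : f = 0 := KTheory.V.ofProj_eq_zero_iff.1 (hRR.ofV_injective (by
      rw [map_zero, ← neg_eq_zero, ← hidx, h]))
    refine ⟨z, Unitary.mem_iff.2 ⟨hz, ?_⟩, hzw⟩
    rw [hzf, hf0, ZeroMemClass.coe_zero, sub_zero]
  · rintro ⟨z, ⟨hz, hz'⟩, hzw⟩
    obtain ⟨f, hf, hzf, hidx⟩ := KTheory.exists_indexMap_eq_neg_of_isometry hz hzw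
    refine ⟨⟨KTheory.V.ofProj f hf, by rw [hidx, neg_add_cancel]⟩, fun h0 => hz' ?_⟩
    have hf0 : f = 0 := KTheory.V.ofProj_eq_zero_iff.1 (hRR.ofV_injective (by
      rw [map_zero, ← neg_eq_zero, ← hidx, h0]))
    rw [hzf, hf0, ZeroMemClass.coe_zero, sub_zero]
  · rintro ⟨⟨a, ha⟩, hne⟩
    obtain ⟨z, hz, hzw⟩ := hRR.exists_isometry_of_indexMap_add_eq_zero ha.symm
    exact ⟨z, ⟨hz, fun hz' => hne (KTheory.indexMap_eq_zero_of_mem_unitary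
      (Unitary.mem_iff.2 ⟨hz, hz'⟩) hzw)⟩, hzw⟩
  · rintro ⟨z, ⟨hz, hz'⟩, hzw⟩
    obtain ⟨e, he, hze, hidx⟩ := KTheory.exists_indexMap_eq_of_coisometry hz hzw
    refine ⟨⟨KTheory.V.ofProj e he, by rw [hidx, zero_add]⟩, fun h0 => hz' ?_⟩
    have he0 : e = 0 := KTheory.V.ofProj_eq_zero_iff.1 (hRR.ofV_injective (by
      rw [map_zero, ← hidx, ← h0]))
    rw [hze, he0, ZeroMemClass.coe_zero, sub_zero]
  · rintro ⟨⟨a, ha⟩, hne⟩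
    obtain ⟨z, hz, hzw⟩ := hRR.exists_coisometry_of_indexMap_eq (ha.trans (zero_add _))
    exact ⟨z, ⟨hz, fun hz' => hne (KTheory.indexMap_eq_zero_of_mem_unitary
      (Unitary.mem_iff.2 ⟨hz', hz⟩) hzw).symm⟩, hzw⟩
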